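/- Let $H$ be a complex Hilbert space with an orthonormal basis $(e_k)_{k\ge 0}$ (for example $H=\ell_2$), let $c_{00}=\mathrm{span}\{e_k: k\ge 0\}$, and write $\mathbb N=\{1,2,\dots\}$, $\mathbb N_0=\mathbb N\cup\{0\}$. Let $L(H)$ be the bounded linear operators on $H$, $N(H)=\{S\in L(H): S\ne\lambda I \text{ for all }\lambda\in\mathbb C\}$, and $\{S\}'=\{B\in L(H): SB=BS\}$. Call $(r,h)$ admissible if $(r_k)_{k\ge 0}\subseteq\mathbb N_0$ is an increasing sequence and $h:\mathbb N\to\mathbb N_0$ a function such that (i) $r_0=0$, $r_1=4$ and $4r_k<r_{k+1}<6r_k$ for $k\in\mathbb N$; (ii) $h(k)\le k-1$ for $k\in\mathbb N$; (iii) for all $j,n\in\mathbb N$ and $s\in\{0,\dots,n-1\}$ there are infinitely many $k\in\mathbb N$ with $h(k)=j$ and $r_k\equiv s \pmod n$. For an admissible pair $(r,h)$ and a decreasing sequence $(\varepsilon_k)_{k\ge1}$ in $(0,\tfrac12)$ define vectors $u_n\in c_{00}$ $(n\ge 0)$ and a linear map $T:c_{00}\to c_{00}$ simultaneously by $u_0=e_0$,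 $Te_0=0$ and $$Te_j=e_{j-1}\ \text{ if } r_k<j<r_{k+1},\ k\ge 0,\qquad Te_{r_k}=\varepsilon_k e_{r_k-1}+\frac{\sqrt{\varepsilon_k}}{\|u_{h(k)}\|}u_{h(k)}\ \text{ if } k\ge 1,$$ $$u_{r_k}=\frac1{\varepsilon_1\cdots\varepsilon_k}e_{r_k}\ \text{ if } k\ge 1,\qquad u_j=T^{\,r_k-j}u_{r_k}\ \text{ if } r_{k-1}<j<r_k,\ k\ge1 .$$ **Theorem.** Admissible pairs exist. For every admissible pair $(r,h)$, if $(\varepsilon_k)$ decreases to zero sufficiently fast (that is, there are positive bounds $\delta_k(\varepsilon_1,\dots,\varepsilon_{k-1})$, $k\ge1$, such that what follows holds whenever $\varepsilon_k\le\delta_k(\varepsilon_1,\dots,\varepsilon_{k-1})$ for all $k\ge 1$), then $T$ extends to a bounded operator on $H$ (Ambrozie's operator, again denoted $T$) with $\|T\|\le 2$ such that: 1. $T\in N(H)$, $N(H)\not\subseteq\{T\}'$, and for every $S\in N(H)$ with $TS=ST$ one has $\{S\}'=\{T\}'$; 2. the only compact operator $K\in\{T\}'$ is $K=0$. -/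

import Mathlib

/-- The combinatorial data of the construction: an increasing sequence `r` of natural numbers and
a function `h` on the positive integers (the value `h 0` is never used). -/
structure IsAmbroziePair (r h : ℕ → ℕ) : Prop where
  strictMono : StrictMono r
  r_zero : r 0 = 0
  r_one : r 1 = 4
  four_mul_lt : ∀ k, 1 ≤ k → 4 * r k < r (k + 1)
  lt_six_mul : ∀ k, 1 ≤ k → r (k + 1) < 6 * r k
  h_le : ∀ k, 1 ≤ k → h k ≤ k - 1
  infinite : ∀ j n s : ℕ, 1 ≤ j → 1 ≤ n → s < n →
    {k : ℕ | 1 ≤ k ∧ h k = j ∧ r k ≡ s [MOD n]}.Infinite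

/-- The space of finitely supported complex sequences; `e j` is `Finsupp.single j 1`. -/
abbrev C00 : Type := ℕ →₀ ℂ

namespace C00

/-- The `ℓ²`-norm of a finitely supported sequence. -/
noncomputable def norm2 (x : C00) : ℝ := Real.sqrt (∑ j ∈ x.support, ‖x j‖ ^ 2)

end C00

namespace Ambrozie

/-- The least `k` with `j ≤ r k`. For `j ≥ 1`, `r 0 = 0` and `r` increasing it is the `k ≥ 1`
with `r (k - 1) < j ≤ r k`. -/
noncomputable def block (r : ℕ → ℕ) (j : ℕ) : ℕ := sInf {k | j ≤ r k}

/-- The image of the basis vector `e j`, relative to a sequence `v` of finitely supported vectors: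
`e 0 ↦ 0`, `e (r k) ↦ ε k • e (r k - 1) + (√(ε k) / ‖v (h k)‖) • v (h k)` for `k ≥ 1`,
and `e j ↦ e (j - 1)` for all the other `j`. -/
noncomputable def basisImage (r h : ℕ → ℕ) (ε : ℕ → ℝ) (v : ℕ → C00) (j : ℕ) : C00 :=
  if j = 0 then 0
  else if j = r (block r j) then
    (ε (block r j) : ℂ) • Finsupp.single (j - 1) (1 : ℂ) +
      ((Real.sqrt (ε (block r j)) / C00.norm2 (v (h (block r j))) : ℝ) : ℂ) • v (h (block r j))
  else Finsupp.single (j - 1) (1 : ℂ)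

/-- The linear extension of `basisImage` to the finitely supported sequences. -/
noncomputable def shift (r h : ℕ → ℕ) (ε : ℕ → ℝ) (v : ℕ → C00) : C00 →ₗ[ℂ] C00 :=
  Finsupp.linearCombination ℂ (basisImage r h ε v)

/-- The auxiliary vectors `u n`, by strong recursion on `n`: `u 0 = e 0`, and for
`r (k - 1) < n ≤ r k` the vector `u n` is the `(r k - n)`-th iterate of the operator at
`(ε 1 ⋯ ε k)⁻¹ • e (r k)`; only vectors `u m` with `m < n` enter this value
(see `u_eq` and `u_eq_pow` below, which hold without any truncation). -/
noncomputable def u (r h : ℕ → ℕ) (ε : ℕ → ℝ) (n : ℕ) : C00 :=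
  if n = 0 then Finsupp.single 0 1
  else
    ((shift r h ε (fun m => if _hm : m < n then u r h ε m else 0)) ^ (r (block r n) - n))
      (Finsupp.single (r (block r n)) ((∏ i ∈ Finset.Icc 1 (block r n), (ε i : ℂ))⁻¹))
termination_by n

/-- The operator on the finitely supported sequences. -/
noncomputable def op (r h : ℕ → ℕ) (ε : ℕ → ℝ) : C00 →ₗ[ℂ] C00 := shift r h ε (u r h ε)

section Facts

variable {r h : ℕ → ℕ} {ε : ℕ → ℝ}

theorem block_eq (hr : StrictMono r) {k j : ℕ} (h1 : r k < j) (h2 : j ≤ r (k + 1)) :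
    block r j = k + 1 := by
  have hmem : k + 1 ∈ {k | j ≤ r k} := h2
  apply le_antisymm (Nat.sInf_le hmem)
  have h3 : j ≤ r (block r j) := Nat.sInf_mem ⟨k + 1, hmem⟩
  exact Nat.succ_le_of_lt (hr.lt_iff_lt.1 (lt_of_lt_of_le h1 h3))

theorem block_r (hr : StrictMono r) (k : ℕ) : block r (r (k + 1)) = k + 1 :=
  block_eq hr (hr (Nat.lt_succ_self k)) le_rfl

theorem u_zero : u r h ε 0 = Finsupp.single 0 1 := by
  rw [u]; simp

/-- `u (r k) = (ε 1 ⋯ ε k)⁻¹ • e (r k)` for `k ≥ 1`. -/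
theorem u_eq (hp : IsAmbroziePair r h) (k : ℕ) (hk : 1 ≤ k) :
    u r h ε (r k) = (∏ i ∈ Finset.Icc 1 k, (ε i : ℂ))⁻¹ • Finsupp.single (r k) (1 : ℂ) := by
  obtain ⟨k, rfl⟩ := Nat.exists_eq_add_of_le' hk
  have h0 : r (k + 1) ≠ 0 := by
    have := hp.strictMono (Nat.succ_pos k); rw [hp.r_zero] at this; exact this.ne'
  rw [u, if_neg h0, block_r hp.strictMono]
  simp

/-- `T (e 0) = 0`. -/
theorem op_single_zero : op r h ε (Finsupp.single 0 1) = 0 := by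
  simp [op, shift, basisImage]

/-- `T (e j) = e (j - 1)` for `r k < j < r (k + 1)`. -/
theorem op_single (hp : IsAmbroziePair r h) (k j : ℕ) (h1 : r k < j) (h2 : j < r (k + 1)) :
    op r h ε (Finsupp.single j 1) = Finsupp.single (j - 1) 1 := by
  have h0 : j ≠ 0 := by omega
  simp [op, shift, basisImage, h0, block_eq hp.strictMono h1 h2.le, h2.ne]

/-- `T (e (r k)) = ε k • e (r k - 1) + (√(ε k) / ‖u (h k)‖) • u (h k)` for `k ≥ 1`. -/
theorem op_single_r (hp : IsAmbroziePair r h) (k : ℕ) (hk : 1 ≤ k) :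
    op r h ε (Finsupp.single (r k) 1) =
      (ε k : ℂ) • Finsupp.single (r k - 1) (1 : ℂ) +
        ((Real.sqrt (ε k) / C00.norm2 (u r h ε (h k)) : ℝ) : ℂ) • u r h ε (h k) := by
  obtain ⟨k, rfl⟩ := Nat.exists_eq_add_of_le' hk
  have h0 : r (k + 1) ≠ 0 := by
    have := hp.strictMono (Nat.succ_pos k); rw [hp.r_zero] at this; exact this.ne'
  rw [op, shift, Finsupp.linearCombination_single, one_smul, basisImage, if_neg h0,
    block_r hp.strictMono, if_pos rfl]

theorem block_le_of_le {N j : ℕ} (hj : j ≤ r N) : block r j ≤ N := Nat.sInf_le hj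

theorem le_r_block (hr : StrictMono r) (j : ℕ) : j ≤ r (block r j) :=
  Nat.sInf_mem (s := {k | j ≤ r k}) ⟨j, hr.id_le j⟩

theorem basisImage_mem {v : ℕ → C00} {N : ℕ}
    (hv : ∀ m, v m ∈ Finsupp.supported ℂ ℂ {i : ℕ | i ≤ N}) {j : ℕ} (hj : j ≤ N) :
    basisImage r h ε v j ∈ Finsupp.supported ℂ ℂ {i : ℕ | i ≤ N} := by
  have hs : Finsupp.single (j - 1) (1 : ℂ) ∈ Finsupp.supported ℂ ℂ {i : ℕ | i ≤ N} :=
    Finsupp.single_mem_supported ℂ _ (show j - 1 ≤ N by omega)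
  unfold basisImage
  split_ifs
  · exact Submodule.zero_mem _
  · exact Submodule.add_mem _ (Submodule.smul_mem _ _ hs) (Submodule.smul_mem _ _ (hv _))
  · exact hs

theorem shift_pow_mem {v : ℕ → C00} {N : ℕ}
    (hv : ∀ m, v m ∈ Finsupp.supported ℂ ℂ {i : ℕ | i ≤ N}) {x : C00}
    (hx : x ∈ Finsupp.supported ℂ ℂ {i : ℕ | i ≤ N}) (n : ℕ) :
    (shift r h ε v ^ n) x ∈ Finsupp.supported ℂ ℂ {i : ℕ | i ≤ N} := by
  induction n with
  | zero => simpa using hx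
  | succ n ih =>
    rw [pow_succ', Module.End.mul_apply, shift, Finsupp.linearCombination_apply]
    refine Submodule.sum_mem _ fun j hj => Submodule.smul_mem _ _ (basisImage_mem hv ?_)
    exact (Finsupp.mem_supported ℂ _).1 ih hj

theorem u_mem (hr : StrictMono r) (n : ℕ) :
    u r h ε n ∈ Finsupp.supported ℂ ℂ {i : ℕ | i ≤ r (block r n)} := by
  induction n using Nat.strong_induction_on with
  | _ n ih =>
    rw [u]
    split_ifs with hn
    · exact Finsupp.single_mem_supported ℂ _ (Nat.zero_le _)
    · refine shift_pow_mem (fun m => ?_)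
        (Finsupp.single_mem_supported ℂ _ (le_refl (r (block r n)))) _
      split_ifs with hm
      · refine Finsupp.supported_mono (fun i (hi : i ≤ _) => ?_) (ih m hm)
        exact hi.trans (hr.monotone (block_le_of_le (hm.le.trans (le_r_block hr n))))
      · exact Submodule.zero_mem _

/-- `u j = T ^ (r k - j) (u (r k))` for `r (k - 1) < j < r k`, here with `k + 1` for `k`. -/
theorem u_eq_pow (hp : IsAmbroziePair r h) (k j : ℕ) (h1 : r k < j) (h2 : j < r (k + 1)) :
    u r h ε j = (op r h ε ^ (r (k + 1) - j)) (u r h ε (r (k + 1))) := by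
  have hb : block r j = k + 1 := block_eq hp.strictMono h1 h2.le
  have h0 : j ≠ 0 := by omega
  rw [u_eq hp (k + 1) (by omega), u, if_neg h0, hb]
  set v : ℕ → C00 := fun m => if _hm : m < j then u r h ε m else 0 with hvdef
  have hv : ∀ m, v m ∈ Finsupp.supported ℂ ℂ {i : ℕ | i ≤ r (k + 1)} := by
    intro m
    simp only [hvdef]
    split_ifs with hm
    · refine Finsupp.supported_mono (fun i (hi : i ≤ _) => ?_) (u_mem hp.strictMono m)
      exact hi.trans (hp.strictMono.monotone (block_le_of_le (hm.le.trans h2.le)))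
    · exact Submodule.zero_mem _
  have hagree : ∀ i, i ≤ r (k + 1) → basisImage r h ε v i = basisImage r h ε (u r h ε) i := by
    intro i hi
    by_cases hi0 : i = 0
    · simp [basisImage, hi0]
    have hbi : block r i ≤ k + 1 := block_le_of_le hi
    have hb1 : 1 ≤ block r i := by
      by_contra hcon
      have hz : block r i = 0 := by omega
      have := le_r_block hp.strictMono i
      rw [hz, hp.r_zero] at this
      omega
    have hlt : h (block r i) < j := by
      have ha := hp.h_le _ hb1
      have hc : k ≤ r k := hp.strictMono.id_le k
      omega
    simp [basisImage, hvdef, hlt]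
  have hpow : ∀ (n : ℕ) (x : C00), x ∈ Finsupp.supported ℂ ℂ {i : ℕ | i ≤ r (k + 1)} →
      (shift r h ε v ^ n) x = (op r h ε ^ n) x := by
    intro n x hx
    induction n with
    | zero => simp
    | succ n ih =>
      rw [pow_succ', pow_succ', Module.End.mul_apply, Module.End.mul_apply, ← ih, op, shift, shift,
        Finsupp.linearCombination_apply, Finsupp.linearCombination_apply]
      refine Finsupp.sum_congr fun i hi => ?_
      rw [hagree i ((Finsupp.mem_supported ℂ _).1 (shift_pow_mem hv hx n) hi)]
  rw [hpow _ _ (Finsupp.single_mem_supported ℂ _ (le_refl (r (k + 1))))]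
  simp

end Facts

end Ambrozie

/-- `P ε` holds for all decreasing sequences `(ε k)_{k ≥ 1}` in `(0, 1/2)` that tend to `0`
sufficiently fast: there are positive bounds, the one on `ε (k + 1)` depending on
`ε 1, …, ε k`, such that `P ε` holds as soon as `ε` respects them. -/
def HoldsForFastDecreasing (P : (ℕ → ℝ) → Prop) : Prop :=
  ∃ δ : (k : ℕ) → (Fin k → ℝ) → ℝ, (∀ k a, 0 < δ k a) ∧
    ∀ ε : ℕ → ℝ, (∀ k, 1 ≤ k → 0 < ε k ∧ ε k < 1 / 2 ∧ ε (k + 1) ≤ ε k) →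
      (∀ k, ε (k + 1) ≤ δ k (fun i => ε (i + 1))) → P ε

section Operators

variable {H : Type*} [NormedAddCommGroup H] [InnerProductSpace ℂ H]

/-- `T` extends the linear map `T₀` on finitely supported sequences, the latter being regarded as
vectors of `H` through the orthonormal basis `e`. -/
def ExtendsOp (e : HilbertBasis ℕ ℂ H) (T₀ : C00 →ₗ[ℂ] C00) (T : H →L[ℂ] H) : Prop :=
  ∀ x : C00, T (Finsupp.linearCombination ℂ e x) = Finsupp.linearCombination ℂ e (T₀ x)

/-- The set of bounded operators that are not scalar multiples of the identity. -/
def nonScalar (H : Type*) [NormedAddCommGroup H] [InnerProductSpace ℂ H] : Set (H →L[ℂ] H) :=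
  {T | ∀ c : ℂ, T ≠ c • ContinuousLinearMap.id ℂ H}

/-- The commutant of a bounded operator. -/
def commutant (T : H →L[ℂ] H) : Set (H →L[ℂ] H) := {S | T ∘L S = S ∘L T}

end Operators

/-!
An operator commuting with `T` turns out to be a formal power series in `T`, and the same holds for
the operators commuting with a nonscalar power series `S` in `T`. Both assertions of the theorem
follow from this: power series in `T` commute with each other, and the `l`-th coefficient of a
series is its entry at row `r k` and column `r k + l` for all large `k`, which tends to zero for a
compact operator.

*The vectors `u n`.* In terms of them `T` is the unweighted backward shift (`op_u_succ`). Each `u n`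
is a multiple of `e n`, except that for `n` close to the end `r (k + 1)` of its block a multiple of
an iterate of `u (h (k + 1))` is added (`u_block`). This multiple dominates at `n = r (k + 1) - 1`,
since it is larger than the coefficient at `e n` by a factor of order `ε (k + 1) ^ (-1 / 2)`.

*The kernel.* Let `S` be a power series in `T` with lowest exponent `m`. If `S y` is supported below
`n`, then `y` is supported below `n + m` (`IsSeries.coord_eq_zero_of_apply`). Indeed the matrix of
`S` is triangular, and its entries outside the diagonal blocks are tiny compared with everything
that depends on the earlier `ε k` only; the coordinates of `y` in a block are obtained from the
later ones by back substitution.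

*Commuting operators.* Let `B` commute with `S`, where `m ≥ 1`. By the statement on kernels,
`B (u n)` is a combination of `u i` with `i < n + m`, so `B` has a banded matrix with respect to the
vectors `u n`. The highest superdiagonal is periodic modulo `m`, and `‖B (u (r k - 1))‖` is too
small for it to be nonzero, so the matrix is triangular (`HasBandMatrix.eq_zero_of_lt`). If the
diagonals before the `d`-th one are constant, then the `d`-th one is periodic modulo `m`; applying
`B` to `u (r k - 1)`, which is almost a multiple of `u (h k)`, shows that its entry for the residue
class of `r k - 1 - d` agrees in the limit with the one for `h k - d`. All residue classes occur
with `h k` fixed, so the diagonal is constant (`HasBandMatrix.diag_const`). The error terms are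
controlled by the exponential bound `norm_diag_le`, which `ε k` beats because it is chosen after
`r k` and `ε 1, …, ε (k - 1)`. With `S = T` and `m = 1` this also describes the commutant of `T`.
-/

namespace Ambrozie

open Finset Filter Topology

section

/-! ### The parameters -/

/-- The reciprocal `(ε 1 ⋯ ε k)⁻¹`, which is the coefficient of `u (r k)` at `e (r k)`. -/
noncomputable def invProd (ε : ℕ → ℝ) (k : ℕ) : ℝ := (∏ i ∈ Icc 1 k, ε i)⁻¹

/-- A bound for all the coefficients of `u n`, `n ≤ r k`, in terms of `ε 1, …, ε k` only. -/
noncomputable def coeffBound (ε : ℕ → ℝ) (k : ℕ) : ℝ := ∏ i ∈ Icc 1 k, (2 * invProd ε i)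

/-- A quantity depending on `ε 1, …, ε k` only, which dominates everything that `ε (k + 1)` has to
beat. -/
noncomputable def growth (r : ℕ → ℕ) (ε : ℕ → ℝ) (k : ℕ) : ℝ :=
  (k + 3) * (r (k + 2) + 2) * coeffBound ε k

/-- The quantitative form of "`ε` decreases to zero sufficiently fast": the square root of
`ε (k + 1)` is smaller than a high power of the reciprocal of a quantity depending on
`ε 1, …, ε k`. An exponent growing like `r (k + 1)` is needed to beat back substitution along a
block and the exponential bound for diagonals; `8 r (k + 1) + 20` leaves room for all uses. -/
structure IsFast (r : ℕ → ℕ) (ε : ℕ → ℝ) : Prop where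
  pos : ∀ k, 1 ≤ k → 0 < ε k
  lt_half : ∀ k, 1 ≤ k → ε k < 1 / 2
  sqrt_mul_le : ∀ k, Real.sqrt (ε (k + 1)) * growth r ε k ^ (8 * r (k + 1) + 20) ≤ 1

/-- The coefficient of `u (h k)` in `T (u (r k))`. -/
noncomputable def linkCoeff (r h : ℕ → ℕ) (ε : ℕ → ℝ) (k : ℕ) : ℝ :=
  invProd ε k * (Real.sqrt (ε k) / C00.norm2 (u r h ε (h k)))

variable {r h : ℕ → ℕ} {ε : ℕ → ℝ}

theorem invProd_zero : invProd ε 0 = 1 := by simp [invProd]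

theorem invProd_succ (k : ℕ) : invProd ε (k + 1) = invProd ε k * (ε (k + 1))⁻¹ := by
  rw [invProd, invProd, Finset.prod_Icc_succ_top (by omega), mul_inv]

theorem coeffBound_zero : coeffBound ε 0 = 1 := by simp [coeffBound]

theorem coeffBound_succ (k : ℕ) :
    coeffBound ε (k + 1) = coeffBound ε k * (2 * invProd ε (k + 1)) := by
  rw [coeffBound, coeffBound, Finset.prod_Icc_succ_top (by omega)]

theorem IsFast.one_le_invProd (hε : IsFast r ε) (k : ℕ) : 1 ≤ invProd ε k := by
  induction k with
  | zero => rw [invProd_zero]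
  | succ k ih =>
    rw [invProd_succ]
    have h1 := hε.pos (k + 1) (by omega)
    have h2 := hε.lt_half (k + 1) (by omega)
    exact one_le_mul_of_one_le_of_one_le ih ((one_le_inv₀ h1).2 (by linarith))

theorem IsFast.invProd_pos (hε : IsFast r ε) (k : ℕ) : 0 < invProd ε k :=
  lt_of_lt_of_le one_pos (hε.one_le_invProd k)

theorem IsFast.invProd_succ_mul (hε : IsFast r ε) (k : ℕ) :
    invProd ε (k + 1) * ε (k + 1) = invProd ε k := by
  rw [invProd_succ, mul_assoc, inv_mul_cancel₀ (hε.pos (k + 1) (by omega)).ne', mul_one]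

theorem IsFast.invProd_le_succ (hε : IsFast r ε) (k : ℕ) :
    invProd ε k ≤ invProd ε (k + 1) := by
  rw [← hε.invProd_succ_mul k]
  have h2 := hε.lt_half (k + 1) (by omega)
  have := hε.invProd_pos (k + 1)
  nlinarith

theorem IsFast.one_le_coeffBound (hε : IsFast r ε) (k : ℕ) : 1 ≤ coeffBound ε k := by
  induction k with
  | zero => rw [coeffBound_zero]
  | succ k ih =>
    rw [coeffBound_succ]
    exact one_le_mul_of_one_le_of_one_le ih (by linarith [hε.one_le_invProd (k + 1)])

theorem IsFast.coeffBound_le_succ (hε : IsFast r ε) (k : ℕ) :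
    coeffBound ε k ≤ coeffBound ε (k + 1) := by
  rw [coeffBound_succ]
  have := hε.one_le_coeffBound k
  have := hε.one_le_invProd (k + 1)
  nlinarith

theorem IsFast.invProd_le_coeffBound (hε : IsFast r ε) (k : ℕ) :
    invProd ε k ≤ coeffBound ε k := by
  rcases k with _ | k
  · rw [invProd_zero, coeffBound_zero]
  · rw [coeffBound_succ]
    have := hε.one_le_coeffBound k
    have := hε.one_le_invProd (k + 1)
    nlinarith

theorem IsFast.two_mul_inv_le_coeffBound (hε : IsFast r ε) (k : ℕ) :
    2 * (ε (k + 1))⁻¹ ≤ coeffBound ε (k + 1) := by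
  rw [coeffBound_succ, invProd_succ]
  have h1 := hε.one_le_coeffBound k
  have h2 := hε.one_le_invProd k
  have h3 : 0 < (ε (k + 1))⁻¹ := inv_pos.2 (hε.pos (k + 1) (by omega))
  have h4 : (ε (k + 1))⁻¹ ≤ invProd ε k * (ε (k + 1))⁻¹ := by nlinarith
  nlinarith

theorem IsFast.growth_mono (hr : StrictMono r) (hε : IsFast r ε) : Monotone (growth r ε) := by
  refine monotone_nat_of_le_succ fun k => ?_
  unfold growth
  have h1 : (r (k + 2) : ℝ) ≤ r (k + 1 + 2) := by
    exact_mod_cast hr.monotone (by omega)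
  have h2 := hε.coeffBound_le_succ k
  have h3 := hε.one_le_coeffBound k
  push_cast
  gcongr
  · linarith

theorem IsFast.factors_le_growth (hε : IsFast r ε) (k : ℕ) :
    (k + 3 : ℝ) ≤ growth r ε k ∧ (r (k + 2) + 2 : ℝ) ≤ growth r ε k ∧
      coeffBound ε k ≤ growth r ε k ∧ (k + 3 : ℝ) * (r (k + 2) + 2) ≤ growth r ε k ∧
      (k + 3 : ℝ) * coeffBound ε k ≤ growth r ε k := by
  have h1 : (1 : ℝ) ≤ k + 3 := by linarith [Nat.cast_nonneg (α := ℝ) k]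
  have h2 : (1 : ℝ) ≤ r (k + 2) + 2 := by linarith [Nat.cast_nonneg (α := ℝ) (r (k + 2))]
  have h3 := hε.one_le_coeffBound k
  have h12 : (1 : ℝ) ≤ (k + 3) * (r (k + 2) + 2) := one_le_mul_of_one_le_of_one_le h1 h2
  unfold growth
  refine ⟨?_, ?_, ?_, ?_, ?_⟩
  · rw [mul_assoc]
    exact le_mul_of_one_le_right (by linarith) (one_le_mul_of_one_le_of_one_le h2 h3)
  · rw [mul_comm (k + 3 : ℝ), mul_assoc]
    exact le_mul_of_one_le_right (by linarith) (one_le_mul_of_one_le_of_one_le h1 h3)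
  · exact le_mul_of_one_le_left (by linarith) h12
  · exact le_mul_of_one_le_right (by linarith) h3
  · rw [mul_right_comm]
    exact le_mul_of_one_le_right (by positivity) h2

theorem IsFast.three_le_growth (hε : IsFast r ε) (k : ℕ) : 3 ≤ growth r ε k := by
  have := (hε.factors_le_growth k).1
  linarith [Nat.cast_nonneg (α := ℝ) k]

/-- `√(ε (k + 1))` beats every power of `growth r ε k` up to the exponent `8 r (k + 1) + 20`, with
the remaining power to spare. -/
theorem IsFast.sqrt_mul_pow_le (hε : IsFast r ε) (k : ℕ) {p q : ℕ}
    (hpq : p + q ≤ 8 * r (k + 1) + 20) :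
    Real.sqrt (ε (k + 1)) * growth r ε k ^ p ≤ (growth r ε k ^ q)⁻¹ := by
  have h3 := hε.three_le_growth k
  have hpos : 0 < growth r ε k ^ q := by positivity
  rw [← one_div, le_div_iff₀ hpos, mul_assoc, ← pow_add]
  refine le_trans ?_ (hε.sqrt_mul_le k)
  exact mul_le_mul_of_nonneg_left (pow_le_pow_right₀ (by linarith) hpq) (Real.sqrt_nonneg _)

theorem IsFast.le_sqrt (hε : IsFast r ε) (k : ℕ) : ε (k + 1) ≤ Real.sqrt (ε (k + 1)) := by
  have h1 := hε.pos (k + 1) (by omega)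
  have h2 := hε.lt_half (k + 1) (by omega)
  apply Real.le_sqrt_of_sq_le
  nlinarith

theorem IsFast.sqrt_le_one (hε : IsFast r ε) (k : ℕ) : Real.sqrt (ε (k + 1)) ≤ 1 := by
  have h2 := hε.lt_half (k + 1) (by omega)
  exact Real.sqrt_le_one.2 (by linarith)

/-! ### The vectors `u n` -/

theorem exists_block (hp : IsAmbroziePair r h) (n : ℕ) : ∃ k, r k ≤ n ∧ n < r (k + 1) := by
  by_contra! hcon
  have : ∀ k, r k ≤ n := by
    intro k
    induction k with
    | zero => rw [hp.r_zero]; exact Nat.zero_le _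
    | succ k ih => exact hcon k ih
  have h1 := this (n + 1)
  have h2 := hp.strictMono.id_le (n + 1)
  simp only [id_eq] at h2
  omega

theorem self_lt_r (hp : IsAmbroziePair r h) (k : ℕ) (hk : 1 ≤ k) : k < r k := by
  induction k, hk using Nat.le_induction with
  | base => rw [hp.r_one]; omega
  | succ k hk ih => have := hp.four_mul_lt k hk; omega

theorem le_r (hp : IsAmbroziePair r h) (k : ℕ) : k ≤ r k := hp.strictMono.id_le k

theorem h_succ_le (hp : IsAmbroziePair r h) (k : ℕ) : h (k + 1) ≤ k := by
  have := hp.h_le (k + 1) (by omega)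
  omega

/-- There is room for `h (k + 1)` and more between `r k` and `r (k + 1)`. -/
theorem gap (hp : IsAmbroziePair r h) (k : ℕ) : r k + h (k + 1) + 1 < r (k + 1) := by
  have h1 := h_succ_le hp k
  rcases Nat.eq_zero_or_pos k with rfl | hk
  · rw [hp.r_zero, zero_add, hp.r_one]; omega
  · have := self_lt_r hp k hk
    have := hp.four_mul_lt k hk
    omega

theorem u_r (hp : IsAmbroziePair r h) (k : ℕ) :
    u r h ε (r k) = (invProd ε k : ℂ) • Finsupp.single (r k) (1 : ℂ) := by
  rcases Nat.eq_zero_or_pos k with rfl | hk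
  · rw [hp.r_zero, u_zero, invProd_zero]; simp
  · rw [u_eq hp k hk, invProd]; push_cast; rfl

theorem op_u_r (hp : IsAmbroziePair r h) (hε : IsFast r ε) (k : ℕ) :
    op r h ε (u r h ε (r (k + 1))) =
      (invProd ε k : ℂ) • Finsupp.single (r (k + 1) - 1) (1 : ℂ) +
        (linkCoeff r h ε (k + 1) : ℂ) • u r h ε (h (k + 1)) := by
  rw [u_r hp, map_smul, op_single_r hp (k + 1) (by omega), smul_add, smul_smul, smul_smul,
    ← hε.invProd_succ_mul k, linkCoeff]
  push_cast
  rfl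

/-- Inside a block `T` is the backward shift. -/
theorem op_pow_single (hp : IsAmbroziePair r h) {k j : ℕ} (hj : r k ≤ j) :
    ∀ l, j + l < r (k + 1) →
      (op r h ε ^ l) (Finsupp.single (j + l) (1 : ℂ)) = Finsupp.single j 1 := by
  intro l
  induction l with
  | zero => intro _; simp
  | succ l ih =>
    intro hl
    rw [pow_succ, Module.End.mul_apply, op_single hp k _ (by omega) hl]
    exact ih (by omega)

theorem op_u_zero : op r h ε (u r h ε 0) = 0 := by rw [u_zero, op_single_zero]

theorem op_pow_u_of_forall {N : ℕ}
    (hN : ∀ n, n + 1 ≤ N → op r h ε (u r h ε (n + 1)) = u r h ε n) (n : ℕ) (hn : n ≤ N) (l : ℕ) :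
    (op r h ε ^ l) (u r h ε n) = if l ≤ n then u r h ε (n - l) else 0 := by
  induction l with
  | zero => simp
  | succ l ih =>
    rw [pow_succ', Module.End.mul_apply, ih]
    by_cases h1 : l + 1 ≤ n
    · rw [if_pos h1, if_pos (by omega)]
      have := hN (n - (l + 1)) (by omega)
      rwa [show n - (l + 1) + 1 = n - l by omega] at this
    · rw [if_neg h1]
      split_ifs with h2
      · rw [show n - l = 0 by omega, op_u_zero]
      · rw [map_zero]

theorem op_pow_u_r (hp : IsAmbroziePair r h) (hε : IsFast r ε) (k p : ℕ)
    (hpk : r k + p + 1 ≤ r (k + 1)) :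
    (op r h ε ^ (p + 1)) (u r h ε (r (k + 1))) =
      (invProd ε k : ℂ) • Finsupp.single (r (k + 1) - 1 - p) (1 : ℂ) +
        (linkCoeff r h ε (k + 1) : ℂ) • (op r h ε ^ p) (u r h ε (h (k + 1))) := by
  rw [pow_succ, Module.End.mul_apply, op_u_r hp hε, map_add, map_smul, map_smul]
  have := op_pow_single (ε := ε) hp (k := k) (j := r (k + 1) - 1 - p) (by omega) p (by omega)
  rw [show r (k + 1) - 1 - p + p = r (k + 1) - 1 by omega] at this
  rw [this]

theorem op_u_succ_of_le (hp : IsAmbroziePair r h) (hε : IsFast r ε) (k : ℕ) :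
    ∀ n, n + 1 ≤ r k → op r h ε (u r h ε (n + 1)) = u r h ε n := by
  induction k with
  | zero => intro n hn; rw [hp.r_zero] at hn; omega
  | succ k ih =>
    intro n hn
    have hstep : ∀ j, r k < j → j ≤ r (k + 1) →
        u r h ε j = (op r h ε ^ (r (k + 1) - j)) (u r h ε (r (k + 1))) := by
      intro j h1 h2
      rcases h2.lt_or_eq with h2 | rfl
      · exact u_eq_pow hp k j h1 h2
      · simp
    rcases Nat.lt_or_ge (r k) (n + 1) with h1 | h1
    · rw [hstep (n + 1) h1 hn, ← Module.End.mul_apply, ← pow_succ',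
        show r (k + 1) - (n + 1) + 1 = r (k + 1) - n by omega]
      rcases (show r k ≤ n by omega).lt_or_eq with h2 | rfl
      · exact (hstep n h2 (by omega)).symm
      -- At the bottom of the block the iterate of `u (h (k + 1))` has already vanished.
      · have hgap := gap hp k
        obtain ⟨p, hpp⟩ : ∃ p, r (k + 1) = r k + p + 1 := ⟨r (k + 1) - r k - 1, by omega⟩
        rw [show r (k + 1) - r k = p + 1 by omega, op_pow_u_r hp hε k p (by omega),
          op_pow_u_of_forall ih _ ((h_succ_le hp k).trans (le_r hp k)), if_neg (by omega),
          smul_zero, add_zero, show r (k + 1) - 1 - p = r k by omega, u_r hp]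
    · exact ih n h1

/-- In terms of the vectors `u n` the operator is the unweighted backward shift. -/
theorem op_u_succ (hp : IsAmbroziePair r h) (hε : IsFast r ε) (n : ℕ) :
    op r h ε (u r h ε (n + 1)) = u r h ε n :=
  op_u_succ_of_le hp hε (n + 1) n (le_r hp _)

theorem op_pow_u (hp : IsAmbroziePair r h) (hε : IsFast r ε) (l n : ℕ) :
    (op r h ε ^ l) (u r h ε n) = if l ≤ n then u r h ε (n - l) else 0 :=
  op_pow_u_of_forall (N := n) (fun m _ => op_u_succ hp hε m) n le_rfl l

/-- On the block `r k ≤ n < r (k + 1)`, `u n` is a multiple of `e n` plus a multiple of an iterate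
of `u (h (k + 1))`, which vanishes unless `n` is close to the end of the block. -/
theorem u_block (hp : IsAmbroziePair r h) (hε : IsFast r ε) {k n : ℕ} (h1 : r k ≤ n)
    (h2 : n < r (k + 1)) :
    u r h ε n = (invProd ε k : ℂ) • Finsupp.single n (1 : ℂ) +
      (linkCoeff r h ε (k + 1) : ℂ) •
        (op r h ε ^ (r (k + 1) - 1 - n)) (u r h ε (h (k + 1))) := by
  have := op_pow_u_r hp hε k (r (k + 1) - 1 - n) (by omega)
  rw [op_pow_u hp hε, if_pos (by omega)] at this
  rwa [show r (k + 1) - (r (k + 1) - 1 - n + 1) = n by omega,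
    show r (k + 1) - 1 - (r (k + 1) - 1 - n) = n by omega] at this

theorem u_block_of_lt (hp : IsAmbroziePair r h) (hε : IsFast r ε) {k n : ℕ} (h1 : r k ≤ n)
    (h2 : n + h (k + 1) + 1 < r (k + 1)) :
    u r h ε n = (invProd ε k : ℂ) • Finsupp.single n (1 : ℂ) := by
  rw [u_block hp hε h1 (by omega), op_pow_u hp hε, if_neg (by omega), smul_zero, add_zero]

theorem u_apply_eq_zero (hp : IsAmbroziePair r h) (hε : IsFast r ε) {n i : ℕ} (hni : n < i) :
    u r h ε n i = 0 := by
  induction n using Nat.strong_induction_on generalizing i with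
  | _ n ih =>
    obtain ⟨k, h1, h2⟩ := exists_block hp n
    rw [u_block hp hε h1 h2, op_pow_u hp hε]
    have hgap := gap hp k
    have hk := h_succ_le hp k
    have hkr := le_r hp k
    have hs : ∀ c : ℂ, Finsupp.single n c i = 0 := fun c => by
      rw [Finsupp.single_apply, if_neg (by omega)]
    split_ifs with h3
    · have : u r h ε (h (k + 1) - (r (k + 1) - 1 - n)) i = 0 := by
        rcases Nat.eq_zero_or_pos n with rfl | hn
        · omega
        · exact ih _ (by omega) (by omega)
      simp [hs, this]
    · simp [hs]

theorem u_apply_self (hp : IsAmbroziePair r h) (hε : IsFast r ε) {k n : ℕ} (h1 : r k ≤ n)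
    (h2 : n < r (k + 1)) : u r h ε n n = invProd ε k := by
  rw [u_block hp hε h1 h2, op_pow_u hp hε]
  have hgap := gap hp k
  have hk := h_succ_le hp k
  have hkr := le_r hp k
  split_ifs with h3
  · have : u r h ε (h (k + 1) - (r (k + 1) - 1 - n)) n = 0 :=
      u_apply_eq_zero hp hε (by omega)
    simp [this]
  · simp

theorem one_le_norm_u_apply_self (hp : IsAmbroziePair r h) (hε : IsFast r ε) (n : ℕ) :
    1 ≤ ‖u r h ε n n‖ := by
  obtain ⟨k, h1, h2⟩ := exists_block hp n
  rw [u_apply_self hp hε h1 h2, Complex.norm_real, Real.norm_of_nonneg (hε.invProd_pos k).le]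
  exact hε.one_le_invProd k

theorem norm_apply_le_norm2 (x : C00) (i : ℕ) : ‖x i‖ ≤ C00.norm2 x := by
  unfold C00.norm2
  apply Real.le_sqrt_of_sq_le
  by_cases hi : i ∈ x.support
  · exact Finset.single_le_sum (f := fun j => ‖x j‖ ^ 2) (fun j _ => by positivity) hi
  · rw [Finsupp.notMem_support_iff.1 hi]
    simpa using Finset.sum_nonneg (fun j _ => by positivity)

theorem one_le_norm2_u (hp : IsAmbroziePair r h) (hε : IsFast r ε) (n : ℕ) :
    1 ≤ C00.norm2 (u r h ε n) :=
  (one_le_norm_u_apply_self hp hε n).trans (norm_apply_le_norm2 _ _)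

theorem linkCoeff_pos (hp : IsAmbroziePair r h) (hε : IsFast r ε) (k : ℕ) :
    0 < linkCoeff r h ε (k + 1) := by
  have h1 := hε.invProd_pos (k + 1)
  have h2 := hε.pos (k + 1) (by omega)
  have h3 := one_le_norm2_u hp hε (h (k + 1))
  unfold linkCoeff
  positivity

theorem linkCoeff_le (hp : IsAmbroziePair r h) (hε : IsFast r ε) (k : ℕ) :
    linkCoeff r h ε (k + 1) ≤ invProd ε (k + 1) * Real.sqrt (ε (k + 1)) := by
  have h1 := hε.invProd_pos (k + 1)
  exact mul_le_mul_of_nonneg_left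
    (div_le_self (Real.sqrt_nonneg _) (one_le_norm2_u hp hε (h (k + 1)))) h1.le

theorem norm_u_apply_block_le (hp : IsAmbroziePair r h) (hε : IsFast r ε) {k n : ℕ}
    (h1 : r k ≤ n) (h2 : n < r (k + 1)) {M : ℝ} (hM : 0 ≤ M)
    (hu : ∀ n i, n ≤ r k → ‖u r h ε n i‖ ≤ M) (i : ℕ) :
    ‖u r h ε n i‖ ≤ invProd ε k + linkCoeff r h ε (k + 1) * M := by
  rw [u_block hp hε h1 h2, op_pow_u hp hε, Finsupp.add_apply, Finsupp.smul_apply,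
    Finsupp.smul_apply]
  refine (norm_add_le _ _).trans (add_le_add ?_ ?_)
  · rw [norm_smul, Complex.norm_real, Real.norm_of_nonneg (hε.invProd_pos k).le,
      Finsupp.single_apply]
    refine mul_le_of_le_one_right (hε.invProd_pos k).le ?_
    split_ifs <;> simp
  · rw [norm_smul, Complex.norm_real, Real.norm_of_nonneg (linkCoeff_pos hp hε k).le]
    refine mul_le_mul_of_nonneg_left ?_ (linkCoeff_pos hp hε k).le
    split_ifs
    · have hk := h_succ_le hp k
      have hkr := le_r hp k
      exact hu _ _ (by omega)
    · simpa using hM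

theorem norm_u_apply_le (hp : IsAmbroziePair r h) (hε : IsFast r ε) (k : ℕ) :
    ∀ n i, n ≤ r k → ‖u r h ε n i‖ ≤ coeffBound ε k := by
  induction k with
  | zero =>
    intro n i hn
    rw [hp.r_zero] at hn
    rw [show n = 0 by omega, u_zero, coeffBound_zero, Finsupp.single_apply]
    split_ifs <;> simp
  | succ k ih =>
    intro n i hn
    have hB := hε.one_le_coeffBound k
    have hA := hε.one_le_invProd (k + 1)
    rcases Nat.lt_or_ge n (r k) with h1 | h1
    · exact (ih n i h1.le).trans (hε.coeffBound_le_succ k)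
    rw [coeffBound_succ]
    rcases hn.lt_or_eq with h2 | rfl
    · refine (norm_u_apply_block_le hp hε h1 h2 (by linarith) ih i).trans ?_
      have h3 := hε.invProd_le_succ k
      have h4 := linkCoeff_le hp hε k
      have h5 : invProd ε (k + 1) * Real.sqrt (ε (k + 1)) ≤ invProd ε (k + 1) :=
        mul_le_of_le_one_right (by linarith) (hε.sqrt_le_one k)
      nlinarith
    · rw [u_r hp, Finsupp.smul_apply, norm_smul, Complex.norm_real,
        Real.norm_of_nonneg (by linarith), Finsupp.single_apply]
      have : ‖(if r (k + 1) = i then (1 : ℂ) else 0)‖ ≤ 1 := by split_ifs <;> simp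
      nlinarith

/-- Relative to the leading coefficient of `u (r (k + 1))`, the coefficients of all the `u n`,
`n ≤ r (k + 1)`, below the position `r (k + 1)` are of order `√(ε (k + 1))`. -/
theorem norm_u_apply_le_sqrt (hp : IsAmbroziePair r h) (hε : IsFast r ε) {k n i : ℕ}
    (hn : n ≤ r (k + 1)) (hi : i < r (k + 1)) :
    (invProd ε (k + 1))⁻¹ * ‖u r h ε n i‖ ≤ 2 * Real.sqrt (ε (k + 1)) * coeffBound ε k := by
  have hB := hε.one_le_coeffBound k
  have hA := hε.invProd_pos (k + 1)
  have hs := hε.le_sqrt k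
  have hpos := hε.pos (k + 1) (by omega)
  rw [inv_mul_le_iff₀ hA]
  have hmul := hε.invProd_succ_mul k
  have h1k := hε.one_le_invProd k
  have hAs : invProd ε k ≤ invProd ε (k + 1) * Real.sqrt (ε (k + 1)) := by
    rw [← hmul]; exact mul_le_mul_of_nonneg_left hs hA.le
  rcases Nat.lt_or_ge n (r k) with h1 | h1
  · have := norm_u_apply_le hp hε k n i h1.le
    nlinarith
  rcases hn.lt_or_eq with h2 | rfl
  · refine (norm_u_apply_block_le hp hε h1 h2 (by linarith)
      (norm_u_apply_le hp hε k) i).trans ?_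
    have h4 := linkCoeff_le hp hε k
    nlinarith
  · rw [u_r hp, Finsupp.smul_apply, Finsupp.single_apply, if_neg (by omega), smul_zero, norm_zero]
    positivity

/-! ### Finitely supported vectors with support below a given index -/

/-- The span of `e 0, …, e (N - 1)`, which is also the span of `u 0, …, u (N - 1)`. -/
noncomputable def below (N : ℕ) : Submodule ℂ C00 := Finsupp.supported ℂ ℂ {i : ℕ | i < N}

theorem mem_below {N : ℕ} {x : C00} : x ∈ below N ↔ ∀ i, N ≤ i → x i = 0 := by
  rw [below, Finsupp.mem_supported']
  simp

theorem below_mono {M N : ℕ} (hMN : M ≤ N) : below M ≤ below N :=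
  Finsupp.supported_mono fun _ hi => lt_of_lt_of_le hi hMN

theorem exists_mem_below (x : C00) : ∃ N, x ∈ below N := by
  refine ⟨x.support.sup id + 1, mem_below.2 fun i hi => ?_⟩
  by_contra hx
  have := Finset.le_sup (f := id) (Finsupp.mem_support_iff.2 hx)
  simp only [id_eq] at this
  omega

theorem u_mem_below (hp : IsAmbroziePair r h) (hε : IsFast r ε) {n N : ℕ} (hn : n < N) :
    u r h ε n ∈ below N :=
  mem_below.2 fun _ hi => u_apply_eq_zero hp hε (by omega)

theorem single_mem_below {n N : ℕ} (hn : n < N) : Finsupp.single n (1 : ℂ) ∈ below N :=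
  mem_below.2 fun i hi => by rw [Finsupp.single_apply, if_neg (by omega)]

theorem exists_sum_u (hp : IsAmbroziePair r h) (hε : IsFast r ε) (N : ℕ) :
    ∀ x ∈ below N, ∃ b : ℕ → ℂ, (∀ i, N ≤ i → b i = 0) ∧ x = ∑ i ∈ range N, b i • u r h ε i := by
  induction N with
  | zero =>
    intro x hx
    refine ⟨0, fun _ _ => rfl, ?_⟩
    ext i
    simpa using mem_below.1 hx i (Nat.zero_le _)
  | succ N ih =>
    intro x hx
    have hne : u r h ε N N ≠ 0 := by
      have := one_le_norm_u_apply_self hp hε N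
      intro h0
      rw [h0, norm_zero] at this
      linarith
    obtain ⟨b, hb0, hb⟩ := ih (x - (x N / u r h ε N N) • u r h ε N) (by
      refine mem_below.2 fun i hi => ?_
      rcases hi.lt_or_eq with h1 | rfl
      · simp [mem_below.1 hx i h1, u_apply_eq_zero hp hε h1]
      · simp [hne])
    refine ⟨fun i => if i = N then x N / u r h ε N N else b i, fun i hi => ?_, ?_⟩
    · simp only
      rw [if_neg (by omega)]
      exact hb0 i (by omega)
    · rw [Finset.sum_range_succ]
      simp only [if_true]
      rw [eq_comm, ← eq_sub_iff_add_eq, hb]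
      refine Finset.sum_congr rfl fun i hi => ?_
      rw [if_neg (by simp at hi; omega)]

theorem eq_zero_of_sum_u_eq_zero (hp : IsAmbroziePair r h) (hε : IsFast r ε) (N : ℕ) (b : ℕ → ℂ)
    (hb : ∑ i ∈ range N, b i • u r h ε i = 0) : ∀ i < N, b i = 0 := by
  induction N with
  | zero => intro i hi; omega
  | succ N ih =>
    have hne : u r h ε N N ≠ 0 := by
      have := one_le_norm_u_apply_self hp hε N
      intro h0
      rw [h0, norm_zero] at this
      linarith
    have hN : b N = 0 := by
      have h1 := DFunLike.congr_fun hb N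
      rw [Finsupp.finsetSum_apply, Finset.sum_range_succ, Finset.sum_eq_zero] at h1
      · simpa [hne] using h1
      · intro i hi
        simp [u_apply_eq_zero hp hε (Finset.mem_range.1 hi)]
    rw [Finset.sum_range_succ, hN, zero_smul, add_zero] at hb
    intro i hi
    rcases (show i ≤ N by omega).lt_or_eq with h1 | rfl
    · exact ih hb i h1
    · exact hN

theorem op_pow_mem_below (hp : IsAmbroziePair r h) (hε : IsFast r ε) {N M l : ℕ} (hM : N ≤ M + l)
    {x : C00} (hx : x ∈ below N) : (op r h ε ^ l) x ∈ below M := by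
  obtain ⟨b, -, rfl⟩ := exists_sum_u hp hε N x hx
  rw [map_sum]
  refine Submodule.sum_mem _ fun i hi => ?_
  rw [map_smul, op_pow_u hp hε]
  refine Submodule.smul_mem _ _ ?_
  have := Finset.mem_range.1 hi
  split_ifs
  · exact u_mem_below hp hε (by omega)
  · exact Submodule.zero_mem _

end

section

variable {H : Type*} [NormedAddCommGroup H] [InnerProductSpace ℂ H]

/-! ### Coordinates with respect to the orthonormal basis -/

/-- The embedding of the finitely supported sequences into the Hilbert space. -/
noncomputable abbrev embed (e : HilbertBasis ℕ ℂ H) : C00 →ₗ[ℂ] H :=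
  Finsupp.linearCombination ℂ e

/-- The `i`-th coordinate functional of the orthonormal basis. -/
noncomputable def coord (e : HilbertBasis ℕ ℂ H) (i : ℕ) : H →L[ℂ] ℂ := innerSL ℂ (e i)

variable (e : HilbertBasis ℕ ℂ H)

theorem coord_basis (i j : ℕ) : coord e i (e j) = if i = j then 1 else 0 := by
  rw [coord, innerSL_apply_apply]
  exact orthonormal_iff_ite.1 e.orthonormal i j

theorem embed_single (j : ℕ) : embed e (Finsupp.single j 1) = e j := by simp

theorem norm_basis (j : ℕ) : ‖e j‖ = 1 := e.orthonormal.1 j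

theorem coord_embed (i : ℕ) (x : C00) : coord e i (embed e x) = x i := by
  rw [Finsupp.linearCombination_apply, Finsupp.sum, map_sum]
  simp only [map_smul, coord_basis, smul_eq_mul, mul_ite, mul_one, mul_zero]
  rw [Finset.sum_ite_eq]
  split_ifs with hi
  · rfl
  · exact (Finsupp.notMem_support_iff.1 hi).symm

theorem norm_coord_le (i : ℕ) (y : H) : ‖coord e i y‖ ≤ ‖y‖ := by
  rw [coord, innerSL_apply_apply]
  simpa [norm_basis] using norm_inner_le_norm (𝕜 := ℂ) (e i) y

theorem hasSum_coord (y : H) : HasSum (fun j => coord e j y • e j) y := by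
  have := e.hasSum_repr y
  simp only [e.repr_apply_apply] at this
  exact this

theorem eq_of_coord {x y : H} (hxy : ∀ i, coord e i x = coord e i y) : x = y := by
  have h1 := hasSum_coord e x
  simp only [hxy] at h1
  exact h1.unique (hasSum_coord e y)

theorem hasSum_coord_apply (S : H →L[ℂ] H) (y : H) (i : ℕ) :
    HasSum (fun j => coord e j y * coord e i (S (e j))) (coord e i (S y)) := by
  have h1 := ((coord e i).comp S).hasSum (hasSum_coord e y)
  simpa using! h1

theorem tendsto_coord (y : H) : Tendsto (fun j => ‖coord e j y‖) atTop (𝓝 0) := by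
  have h1 := (e.orthonormal.inner_products_summable y).tendsto_atTop_zero
  have h2 := (Real.continuous_sqrt.tendsto 0).comp h1
  simpa [Function.comp_def, coord] using h2

theorem embed_injective : Function.Injective (embed e) := by
  intro x y hxy
  ext i
  rw [← coord_embed e, ← coord_embed e, hxy]

theorem exists_embed_eq {N : ℕ} {y : H} (hy : ∀ j, N ≤ j → coord e j y = 0) :
    ∃ x ∈ below N, embed e x = y := by
  have h0 : ∀ i, N ≤ i →
      (∑ j ∈ range N, coord e j y • Finsupp.single j (1 : ℂ) : C00) i = 0 := fun i hi => by
    rw [Finsupp.finsetSum_apply]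
    refine Finset.sum_eq_zero fun j hj => ?_
    have := Finset.mem_range.1 hj
    rw [Finsupp.smul_apply, Finsupp.single_apply, if_neg (by omega), smul_zero]
  refine ⟨_, mem_below.2 h0, ?_⟩
  refine eq_of_coord e fun i => ?_
  rw [coord_embed]
  rcases Nat.lt_or_ge i N with h1 | h1
  · rw [Finsupp.finsetSum_apply, Finset.sum_eq_single i]
    · simp
    · intro j _ hji
      rw [Finsupp.smul_apply, Finsupp.single_apply, if_neg hji, smul_zero]
    · intro hi
      simp at hi
      omega
  · rw [h0 i h1, hy i h1]

theorem denseRange_embed : DenseRange (embed e) := by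
  have h1 := e.dense_span
  rw [← Finsupp.range_linearCombination] at h1
  intro y
  have h2 : y ∈ (LinearMap.range (embed e)).topologicalClosure := by rw [h1]; trivial
  simpa [← SetLike.mem_coe, Submodule.topologicalClosure_coe] using! h2

theorem eq_of_embed {S₁ S₂ : H →L[ℂ] H} (hS : ∀ x, S₁ (embed e x) = S₂ (embed e x)) :
    S₁ = S₂ := by
  ext y
  exact congrFun ((denseRange_embed e).equalizer S₁.continuous S₂.continuous (funext hS)) y

theorem eq_of_basis {S₁ S₂ : H →L[ℂ] H} (hS : ∀ j, S₁ (e j) = S₂ (e j)) : S₁ = S₂ := by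
  refine eq_of_embed e fun x => ?_
  rw [Finsupp.linearCombination_apply, Finsupp.sum, map_sum, map_sum]
  simp [hS]

theorem norm_sum_smul_sq (s : Finset ℕ) (c : ℕ → ℂ) :
    ‖∑ i ∈ s, c i • e i‖ ^ 2 = ∑ i ∈ s, ‖c i‖ ^ 2 := by
  have h1 := e.orthonormal.inner_sum c c s
  rw [inner_self_eq_norm_sq_to_K] at h1
  have h2 : ((‖∑ i ∈ s, c i • e i‖ ^ 2 : ℝ) : ℂ) = ((∑ i ∈ s, ‖c i‖ ^ 2 : ℝ) : ℂ) := by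
    push_cast
    simp only [Complex.conj_mul'] at h1
    exact h1
  exact_mod_cast h2

theorem norm_embed (x : C00) : ‖embed e x‖ = C00.norm2 x := by
  rw [C00.norm2, ← norm_sum_smul_sq e, Real.sqrt_sq (norm_nonneg _),
    Finsupp.linearCombination_apply, Finsupp.sum]

variable {r h : ℕ → ℕ} {ε : ℕ → ℝ}

theorem eq_sum_single {N : ℕ} {x : C00} (hx : x ∈ below N) :
    x = ∑ j ∈ range N, x j • Finsupp.single j (1 : ℂ) := by
  conv_lhs => rw [← Finsupp.sum_single x]
  rw [Finsupp.sum_of_support_subset x (s := range N) (fun i hi => ?_) _ (by simp)]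
  · simp
  · rw [Finset.mem_range]
    by_contra hcon
    exact Finsupp.mem_support_iff.1 hi (mem_below.1 hx i (by omega))

theorem embed_eq_sum {N : ℕ} {x : C00} (hx : x ∈ below N) :
    embed e x = ∑ j ∈ range N, x j • e j := by
  conv_lhs => rw [eq_sum_single hx, map_sum]
  simp only [map_smul, embed_single]

theorem op_apply_eq_sum {N : ℕ} {x : C00} (hx : x ∈ below N) :
    op r h ε x = ∑ j ∈ range N, x j • op r h ε (Finsupp.single j 1) := by
  conv_lhs => rw [eq_sum_single hx, map_sum]
  simp only [map_smul]

/-! ### Boundedness of the operator -/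

theorem IsFast.sqrt_le_half_pow (hε : IsFast r ε) (k : ℕ) :
    Real.sqrt (ε (k + 1)) ≤ (1 / 2) ^ (r (k + 1) + 1) := by
  have h1 := hε.sqrt_mul_pow_le k (p := 0) (q := r (k + 1) + 1) (by omega)
  rw [pow_zero, mul_one] at h1
  refine h1.trans ?_
  rw [one_div, inv_pow]
  have h3 := hε.three_le_growth k
  exact inv_anti₀ (by positivity) (pow_le_pow_left₀ (by norm_num) (by linarith) _)

/-- The decomposition of `T` into a weighted backward shift with weights in `[0, 1]` and a summably
small perturbation. -/
theorem exists_op_single_succ (hp : IsAmbroziePair r h) (hε : IsFast r ε) (j : ℕ) :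
    ∃ w : ℝ, ∃ v : C00, 0 ≤ w ∧ w ≤ 1 ∧ ‖embed e v‖ ≤ (1 / 2) ^ (j + 2) ∧
      op r h ε (Finsupp.single (j + 1) 1) = (w : ℂ) • Finsupp.single j (1 : ℂ) + v := by
  obtain ⟨k, h1, h2⟩ := exists_block hp (j + 1)
  rcases h1.lt_or_eq with h1 | h1
  · refine ⟨1, 0, zero_le_one, le_rfl, ?_, ?_⟩
    · rw [map_zero, norm_zero]; positivity
    · rw [op_single hp k _ h1 h2]; simp
  · rcases k with _ | k
    · rw [hp.r_zero] at h1; omega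
    have hpos := hε.pos (k + 1) (by omega)
    have hlt := hε.lt_half (k + 1) (by omega)
    refine ⟨ε (k + 1), ((Real.sqrt (ε (k + 1)) / C00.norm2 (u r h ε (h (k + 1))) : ℝ) : ℂ) •
      u r h ε (h (k + 1)), hpos.le, by linarith, ?_, ?_⟩
    · have hu := one_le_norm2_u hp hε (h (k + 1))
      rw [map_smul, norm_smul, norm_embed, Complex.norm_real, Real.norm_of_nonneg (by positivity),
        div_mul_cancel₀ _ (by linarith)]
      have := hε.sqrt_le_half_pow k
      rwa [h1] at this
    · rw [← h1, op_single_r hp (k + 1) (by omega), h1, Nat.add_sub_cancel]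

theorem norm_embed_op_le (hp : IsAmbroziePair r h) (hε : IsFast r ε) (x : C00) :
    ‖embed e (op r h ε x)‖ ≤ 2 * ‖embed e x‖ := by
  choose w v hw0 hw1 hv heq using fun j => exists_op_single_succ e hp hε j
  obtain ⟨N, hN⟩ := exists_mem_below x
  have hN1 : x ∈ below (N + 1) := below_mono (by omega) hN
  have hx : embed e (op r h ε x) =
      ∑ j ∈ range N, (x (j + 1) * w j) • e j + ∑ j ∈ range N, x (j + 1) • embed e (v j) := by
    rw [op_apply_eq_sum hN1, Finset.sum_range_succ', op_single_zero, smul_zero, add_zero, map_sum,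
      ← Finset.sum_add_distrib]
    refine Finset.sum_congr rfl fun j _ => ?_
    rw [heq, map_smul, (embed e).map_add, map_smul, embed_single, smul_add, smul_smul]
  rw [hx, two_mul]
  refine (norm_add_le _ _).trans (add_le_add ?_ ?_)
  · rw [← abs_of_nonneg (norm_nonneg (embed e x)), ← abs_of_nonneg (norm_nonneg (∑ j ∈ range N, _)),
      ← sq_le_sq, norm_sum_smul_sq, embed_eq_sum e hN1, norm_sum_smul_sq, Finset.sum_range_succ']
    refine le_add_of_le_of_nonneg (Finset.sum_le_sum fun j _ => ?_) (by positivity)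
    rw [norm_mul, Complex.norm_real, Real.norm_of_nonneg (hw0 j)]
    exact pow_le_pow_left₀ (mul_nonneg (norm_nonneg _) (hw0 j))
      (mul_le_of_le_one_right (norm_nonneg _) (hw1 j)) 2
  · have h1 : ∀ j ∈ range N, ‖x (j + 1) • embed e (v j)‖ ≤ ‖embed e x‖ * (1 / 2 / 2 ^ j) := by
      intro j _
      rw [norm_smul, ← coord_embed e]
      refine mul_le_mul (norm_coord_le e _ _) ?_ (norm_nonneg _) (norm_nonneg _)
      refine (hv j).trans ?_
      rw [div_div, ← pow_succ', ← one_div_pow]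
      exact pow_le_pow_of_le_one (by norm_num) (by norm_num) (by omega)
    refine (norm_sum_le_of_le _ h1).trans ?_
    rw [← Finset.mul_sum]
    refine mul_le_of_le_one_right (norm_nonneg _) ?_
    refine (Summable.sum_le_tsum _ (fun j _ => by positivity) (summable_geometric_two' 1)).trans ?_
    rw [tsum_geometric_two']

theorem exists_extension [CompleteSpace H] (hp : IsAmbroziePair r h) (hε : IsFast r ε) :
    ∃ T : H →L[ℂ] H, ExtendsOp e (op r h ε) T ∧ ‖T‖ ≤ 2 := by
  have hb : ∀ x, ‖((embed e) ∘ₗ (op r h ε)) x‖ ≤ 2 * ‖embed e x‖ := norm_embed_op_le e hp hε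
  refine ⟨((embed e) ∘ₗ (op r h ε)).extendOfNorm (embed e), fun x => ?_, ?_⟩
  · exact LinearMap.extendOfNorm_eq (denseRange_embed e) ⟨2, hb⟩ x
  · exact ContinuousLinearMap.opNorm_le_bound _ (by norm_num)
      (LinearMap.norm_extendOfNorm_apply_le (denseRange_embed e) 2 hb)

end

section

variable {H : Type*} [NormedAddCommGroup H] [InnerProductSpace ℂ H]
variable {e : HilbertBasis ℕ ℂ H} {r h : ℕ → ℕ} {ε : ℕ → ℝ} {S : H →L[ℂ] H} {a : ℕ → ℂ}

/-! ### Formal power series in the operator -/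

/-- The bounded operator `S` is given on finitely supported vectors by the formal power series
`∑ a l T ^ l`. The series is finite there because `T` is locally nilpotent: `T ^ N` vanishes on
`below N`. -/
def IsSeries (e : HilbertBasis ℕ ℂ H) (r h : ℕ → ℕ) (ε : ℕ → ℝ) (S : H →L[ℂ] H) (a : ℕ → ℂ) :
    Prop :=
  ∀ N, ∀ x ∈ below N, S (embed e x) = ∑ l ∈ range N, a l • embed e ((op r h ε ^ l) x)

theorem isSeries_of_u (hp : IsAmbroziePair r h) (hε : IsFast r ε) {S : H →L[ℂ] H} {a : ℕ → ℂ}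
    (hS : ∀ n, S (embed e (u r h ε n)) =
      ∑ l ∈ range (n + 1), a l • embed e (u r h ε (n - l))) :
    IsSeries e r h ε S a := by
  have hu : ∀ N n, n < N → S (embed e (u r h ε n)) =
      ∑ l ∈ range N, a l • embed e ((op r h ε ^ l) (u r h ε n)) := by
    intro N n hn
    rw [hS, ← Finset.sum_subset (Finset.range_subset_range.2 (show n + 1 ≤ N by omega))]
    · refine Finset.sum_congr rfl fun l hl => ?_
      rw [op_pow_u hp hε, if_pos (by simp at hl; omega)]
    · intro l _ hl
      rw [op_pow_u hp hε, if_neg (by simp at hl; omega), map_zero, smul_zero]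
  intro N x hx
  obtain ⟨b, -, rfl⟩ := exists_sum_u hp hε N x hx
  rw [map_sum, map_sum]
  simp only [map_sum, map_smul, Finset.smul_sum]
  rw [Finset.sum_comm]
  refine Finset.sum_congr rfl fun n hn => ?_
  rw [hu N n (Finset.mem_range.1 hn), Finset.smul_sum]
  exact Finset.sum_congr rfl fun l _ => smul_comm _ _ _

theorem isSeries_extension (hp : IsAmbroziePair r h) (hε : IsFast r ε) {T : H →L[ℂ] H}
    (hT : ExtendsOp e (op r h ε) T) : IsSeries e r h ε T (fun l => if l = 1 then 1 else 0) := by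
  refine isSeries_of_u hp hε fun n => ?_
  rw [hT]
  rcases n with _ | n
  · simp [op_u_zero]
  · rw [op_u_succ hp hε, Finset.sum_eq_single 1]
    · simp
    · intro l _ hl
      rw [if_neg hl, zero_smul]
    · intro hl
      simp at hl

theorem IsSeries.coord_basis (hS : IsSeries e r h ε S a) (i j : ℕ) :
    coord e i (S (e j)) =
      ∑ l ∈ range (j + 1), a l * ((op r h ε ^ l) (Finsupp.single j 1)) i := by
  rw [← embed_single, hS (j + 1) _ (single_mem_below (by omega)), map_sum]
  simp only [map_smul, coord_embed, smul_eq_mul]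

theorem op_pow_single_block (hp : IsAmbroziePair r h) (hε : IsFast r ε) {k j : ℕ} (h1 : r k ≤ j)
    (h2 : j < r (k + 1)) (l : ℕ) :
    (op r h ε ^ l) (Finsupp.single j (1 : ℂ)) =
      if l + r k ≤ j then Finsupp.single (j - l) 1
      else (((invProd ε k)⁻¹ : ℝ) : ℂ) • (if l ≤ j then u r h ε (j - l) else 0) := by
  split_ifs with h3 h4
  · have := op_pow_single (ε := ε) hp (k := k) (j := j - l) (by omega) l (by omega)
    rwa [Nat.sub_add_cancel (by omega)] at this
  all_goals
    have h5 := op_pow_single (ε := ε) hp (k := k) le_rfl (j - r k) (by omega)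
    rw [Nat.add_sub_cancel' h1] at h5
    have h6 : Finsupp.single (r k) (1 : ℂ) =
        (((invProd ε k)⁻¹ : ℝ) : ℂ) • u r h ε (r k) := by
      rw [u_r hp, smul_smul, ← Complex.ofReal_mul, inv_mul_cancel₀ (hε.invProd_pos k).ne']
      simp
    rw [show l = (l - (j - r k)) + (j - r k) by omega, pow_add, Module.End.mul_apply, h5, h6,
      map_smul, op_pow_u hp hε]
  · rw [if_pos (by omega), show r k - (l - (j - r k)) = j - (l - (j - r k) + (j - r k)) by omega]
  · rw [if_neg (by omega)]

theorem op_pow_single_apply_eq_zero (hp : IsAmbroziePair r h) (hε : IsFast r ε) {i j l : ℕ}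
    (hij : j < i + l) : ((op r h ε ^ l) (Finsupp.single j (1 : ℂ))) i = 0 :=
  mem_below.1 (op_pow_mem_below hp hε (N := j + 1) (M := j + 1 - l) (by omega)
    (single_mem_below (by omega))) i (by omega)

theorem IsSeries.coord_basis_eq (hp : IsAmbroziePair r h) (hε : IsFast r ε)
    (hS : IsSeries e r h ε S a) {k l : ℕ} (hl : r k + l < r (k + 1)) :
    coord e (r k) (S (e (r k + l))) = a l := by
  rw [hS.coord_basis, Finset.sum_eq_single l]
  · rw [op_pow_single_block hp hε (by omega) hl, if_pos (by omega), Nat.add_sub_cancel]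
    simp
  · intro l' hl' hne
    rcases hne.lt_or_gt with h1 | h1
    · rw [op_pow_single_block hp hε (by omega) hl, if_pos (by omega), Finsupp.single_apply,
        if_neg (by omega), mul_zero]
    · rw [op_pow_single_apply_eq_zero hp hε (by omega), mul_zero]
  · intro h1
    simp at h1

theorem add_lt_r_succ (hp : IsAmbroziePair r h) {k l : ℕ} (hl : l < k) :
    r k + l < r (k + 1) := by
  have := hp.four_mul_lt k (by omega)
  have := le_r hp k
  omega

theorem IsSeries.norm_coeff_le (hp : IsAmbroziePair r h) (hε : IsFast r ε)
    (hS : IsSeries e r h ε S a) (l : ℕ) : ‖a l‖ ≤ ‖S‖ := by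
  rw [← hS.coord_basis_eq hp hε (add_lt_r_succ hp (Nat.lt_succ_self l))]
  refine (norm_coord_le e _ _).trans ((S.le_opNorm _).trans ?_)
  rw [norm_basis, mul_one]

theorem norm_op_pow_single_apply_le (hp : IsAmbroziePair r h) (hε : IsFast r ε) {k i j : ℕ}
    (hi : i < r (k + 1)) (h1 : r (k + 1) ≤ j) (h2 : j < r (k + 2)) (l : ℕ) :
    ‖((op r h ε ^ l) (Finsupp.single j (1 : ℂ))) i‖ ≤
      2 * Real.sqrt (ε (k + 1)) * coeffBound ε k := by
  have hB := hε.one_le_coeffBound k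
  have h0 : 0 ≤ 2 * Real.sqrt (ε (k + 1)) * coeffBound ε k := by positivity
  rw [op_pow_single_block hp hε h1 h2]
  split_ifs with h3 h4
  · rwa [Finsupp.single_apply, if_neg (by omega), norm_zero]
  · rw [Finsupp.smul_apply, norm_smul, Complex.norm_real,
      Real.norm_of_nonneg (inv_nonneg.2 (hε.invProd_pos _).le)]
    exact norm_u_apply_le_sqrt hp hε (by omega) hi
  · simpa using h0

/-- The matrix of a power series in `T` is tiny outside the diagonal blocks: entries whose row lies
below `r (k + 1)` and whose column does not. -/
theorem IsSeries.norm_coord_basis_le (hp : IsAmbroziePair r h) (hε : IsFast r ε)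
    (hS : IsSeries e r h ε S a) {k i j : ℕ} (hi : i < r (k + 1)) (hj : r (k + 1) ≤ j) :
    ‖coord e i (S (e j))‖ ≤
      ‖S‖ * (growth r ε k ^ (r (k + 1) + 10))⁻¹ * (1 / 2) ^ j := by
  obtain ⟨q', h1, h2⟩ := exists_block hp j
  have hkq : k + 1 ≤ q' := by
    by_contra hcon
    have := hp.strictMono.monotone (show q' + 1 ≤ k + 1 by omega)
    omega
  obtain ⟨q, rfl⟩ : ∃ q, q' = q + 1 := ⟨q' - 1, by omega⟩
  have hrkq := hp.strictMono.monotone hkq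
  have h2 : j < r (q + 2) := h2
  have hg := hε.factors_le_growth q
  have hg3 := hε.three_le_growth q
  have hB := hε.one_le_coeffBound q
  have hs := Real.sqrt_nonneg (ε (q + 1))
  have hgk : growth r ε k ^ (r (k + 1) + 10) ≤ growth r ε q ^ (r (q + 1) + 10) :=
    (pow_le_pow_left₀ (by linarith [hε.three_le_growth k])
      (hε.growth_mono hp.strictMono (by omega)) _).trans
      (pow_le_pow_right₀ (by linarith) (by omega))
  have hg2 : (2 : ℝ) ^ j ≤ growth r ε q ^ (6 * r (q + 1)) := by
    have h6 : r (q + 2) < 6 * r (q + 1) := hp.lt_six_mul (q + 1) (by omega)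
    exact (pow_le_pow_left₀ (by norm_num) (by linarith) _).trans
      (pow_le_pow_right₀ (by linarith) (by omega))
  rw [hS.coord_basis]
  have hterm : ∀ l ∈ range (j + 1), ‖a l * ((op r h ε ^ l) (Finsupp.single j 1)) i‖ ≤
      ‖S‖ * (2 * Real.sqrt (ε (q + 1)) * coeffBound ε q) := fun l _ => by
    rw [norm_mul]
    exact mul_le_mul (hS.norm_coeff_le hp hε l)
      (norm_op_pow_single_apply_le hp hε (by omega) h1 h2 l) (norm_nonneg _) (norm_nonneg _)
  refine (norm_sum_le_of_le _ hterm).trans ?_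
  rw [Finset.sum_const, Finset.card_range, nsmul_eq_mul]
  have hj' : ((j + 1 : ℕ) : ℝ) ≤ growth r ε q :=
    le_trans (by exact_mod_cast (by omega : j + 1 ≤ r (q + 2) + 2)) hg.2.1
  have hmain := hε.sqrt_mul_pow_le q (p := 3) (q := (r (q + 1) + 10) + 6 * r (q + 1)) (by omega)
  calc ((j + 1 : ℕ) : ℝ) * (‖S‖ * (2 * Real.sqrt (ε (q + 1)) * coeffBound ε q))
      ≤ growth r ε q * (‖S‖ * (growth r ε q * Real.sqrt (ε (q + 1)) * growth r ε q)) := by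
        gcongr
        · linarith
        · exact hg.2.2.1
    _ = ‖S‖ * (Real.sqrt (ε (q + 1)) * growth r ε q ^ 3) := by ring
    _ ≤ ‖S‖ * (growth r ε q ^ ((r (q + 1) + 10) + 6 * r (q + 1)))⁻¹ := by gcongr
    _ = ‖S‖ * ((growth r ε q ^ (r (q + 1) + 10))⁻¹ * (growth r ε q ^ (6 * r (q + 1)))⁻¹) := by
        rw [pow_add, mul_inv]
    _ ≤ ‖S‖ * ((growth r ε k ^ (r (k + 1) + 10))⁻¹ * (2 ^ j)⁻¹) := by
        have hk3 := hε.three_le_growth k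
        gcongr
    _ = _ := by rw [one_div, inv_pow, mul_assoc]

theorem IsSeries.coord_basis_eq_zero (hp : IsAmbroziePair r h) (hε : IsFast r ε)
    (hS : IsSeries e r h ε S a) {m : ℕ} (ha : ∀ l < m, a l = 0) {i j : ℕ} (hij : j < i + m) :
    coord e i (S (e j)) = 0 := by
  rw [hS.coord_basis]
  refine Finset.sum_eq_zero fun l _ => ?_
  rcases Nat.lt_or_ge l m with h1 | h1
  · rw [ha l h1, zero_mul]
  · rw [op_pow_single_apply_eq_zero hp hε (by omega), mul_zero]

theorem IsSeries.coord_basis_diag (hp : IsAmbroziePair r h) (hε : IsFast r ε)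
    (hS : IsSeries e r h ε S a) {m : ℕ} (ha : ∀ l < m, a l = 0) (i : ℕ) :
    coord e i (S (e (i + m))) = a m * ((op r h ε ^ m) (Finsupp.single (i + m) 1)) i := by
  rw [hS.coord_basis, Finset.sum_eq_single m]
  · intro l _ hne
    rcases hne.lt_or_gt with h1 | h1
    · rw [ha l h1, zero_mul]
    · rw [op_pow_single_apply_eq_zero hp hε (by omega), mul_zero]
  · intro h1
    simp at h1

theorem op_pow_single_diag_ne_zero (hp : IsAmbroziePair r h) (hε : IsFast r ε) (i m : ℕ) :
    ((op r h ε ^ m) (Finsupp.single (i + m) (1 : ℂ))) i ≠ 0 := by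
  obtain ⟨k, h1, h2⟩ := exists_block hp (i + m)
  rw [op_pow_single_block hp hε h1 h2]
  split_ifs with h3 h4
  · simp
  · rw [Nat.add_sub_cancel, Finsupp.smul_apply, smul_eq_mul]
    have := one_le_norm_u_apply_self hp hε i
    refine mul_ne_zero ?_ (norm_pos_iff.1 (by linarith))
    exact_mod_cast (inv_pos.2 (hε.invProd_pos k)).ne'
  · omega

theorem le_norm_op_pow_single_diag (hp : IsAmbroziePair r h) (hε : IsFast r ε) {k i m : ℕ}
    (h0 : r k ≤ i) (h1 : r (k + 1) ≤ i + m) (h2 : i + m < r (k + 2)) :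
    ε (k + 1) ≤ ‖((op r h ε ^ m) (Finsupp.single (i + m) (1 : ℂ))) i‖ := by
  rw [op_pow_single_block hp hε h1 h2]
  have hlt := hε.lt_half (k + 1) (by omega)
  split_ifs with h3 h4
  · simp; linarith
  · rw [Nat.add_sub_cancel, Finsupp.smul_apply, smul_eq_mul, norm_mul, Complex.norm_real,
      u_apply_self hp hε h0 (by omega), Complex.norm_real,
      Real.norm_of_nonneg (hε.invProd_pos k).le,
      Real.norm_of_nonneg (inv_pos.2 (hε.invProd_pos _)).le, ← hε.invProd_succ_mul k,
      inv_mul_cancel_left₀ (hε.invProd_pos _).ne']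
  · omega

end

section

variable {H : Type*} [NormedAddCommGroup H] [InnerProductSpace ℂ H]
variable {e : HilbertBasis ℕ ℂ H} {r h : ℕ → ℕ} {ε : ℕ → ℝ} {S : H →L[ℂ] H} {a : ℕ → ℂ}

/-! ### The kernel of a power series in the operator -/

/-- Back substitution: a sequence each of whose terms is bounded by a multiple of the sum of the
later ones and a constant. -/
theorem le_of_le_mul_sum {z : ℕ → ℝ} {ρ c : ℝ} {p q : ℕ} (hz : ∀ j, 0 ≤ z j) (hρ : 0 ≤ ρ)
    (hc : 0 ≤ c) (hstep : ∀ j, p ≤ j → j < q → z j ≤ ρ * (∑ i ∈ Ico (j + 1) q, z i + c)) {j : ℕ}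
    (hpj : p ≤ j) (hjq : j < q) : z j ≤ (1 + ρ) ^ q * c := by
  have hmain : ∀ t, p + t ≤ q → ∑ i ∈ Ico (q - t) q, z i + c ≤ (1 + ρ) ^ t * c := by
    intro t
    induction t with
    | zero => intro _; simp
    | succ t ih =>
      intro ht
      have h1 := ih (by omega)
      have h2 := hstep (q - (t + 1)) (by omega) (by omega)
      rw [Finset.sum_eq_sum_Ico_succ_bot (by omega)]
      rw [show q - (t + 1) + 1 = q - t by omega] at h2 ⊢
      calc _ ≤ (1 + ρ) * (∑ i ∈ Ico (q - t) q, z i + c) := by linarith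
        _ ≤ (1 + ρ) * ((1 + ρ) ^ t * c) := by gcongr
        _ = _ := by ring
  have h1 := hmain (q - j) (by omega)
  rw [show q - (q - j) = j by omega, Finset.sum_eq_sum_Ico_succ_bot hjq] at h1
  have h2 : 0 ≤ ∑ i ∈ Ico (j + 1) q, z i := Finset.sum_nonneg fun i _ => hz i
  have h3 : (1 + ρ) ^ (q - j) ≤ (1 + ρ) ^ q := pow_le_pow_right₀ (by linarith) (by omega)
  nlinarith

/-- One step of the back substitution: row `i` of the equation `S y = 0`, solved for the coordinate
`i + m` of `y`. -/
theorem IsSeries.mul_coord_le (hp : IsAmbroziePair r h) (hε : IsFast r ε)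
    (hS : IsSeries e r h ε S a) {m : ℕ} (ha : ∀ l < m, a l = 0) {y : H} {k i : ℕ} {M : ℝ}
    (hy : coord e i (S y) = 0) (hM : ∀ j, r (k + 1) ≤ j → ‖coord e j y‖ ≤ M)
    (hi : i + m < r (k + 1)) :
    ‖coord e (i + m) y‖ * ‖coord e i (S (e (i + m)))‖ ≤
      ‖S‖ * (∑ j ∈ Ico (i + m + 1) (r (k + 1)), ‖coord e j y‖ +
        2 * (growth r ε k ^ (r (k + 1) + 10))⁻¹ * M) := by
  have hM0 : 0 ≤ M := (norm_nonneg _).trans (hM _ le_rfl)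
  have hg3 := hε.three_le_growth k
  have hsum := hasSum_coord_apply e S y i
  rw [hy] at hsum
  have h1 := hsum.summable.sum_add_tsum_nat_add (r (k + 1))
  rw [hsum.tsum_eq, ← Finset.sum_range_add_sum_Ico _ (show i + m + 1 ≤ r (k + 1) by omega),
    Finset.sum_range_succ, Finset.sum_eq_zero, zero_add] at h1
  swap
  · intro j hj
    rw [hS.coord_basis_eq_zero hp hε ha (by simpa using hj), mul_zero]
  have h2 : ‖∑' t, coord e (t + r (k + 1)) y * coord e i (S (e (t + r (k + 1))))‖ ≤
      M * ‖S‖ * (growth r ε k ^ (r (k + 1) + 10))⁻¹ * 2 := by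
    refine tsum_of_norm_bounded (hasSum_geometric_two.mul_left _) fun t => ?_
    rw [norm_mul]
    have h3 := hS.norm_coord_basis_le hp hε (k := k) (i := i) (j := t + r (k + 1)) (by omega)
      (by omega)
    have h4 : (1 / 2 : ℝ) ^ (t + r (k + 1)) ≤ (1 / 2) ^ t :=
      pow_le_pow_of_le_one (by norm_num) (by norm_num) (by omega)
    calc _ ≤ M * (‖S‖ * (growth r ε k ^ (r (k + 1) + 10))⁻¹ * (1 / 2) ^ t) := by
          refine mul_le_mul (hM _ (by omega)) (h3.trans ?_) (norm_nonneg _) hM0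
          gcongr
      _ = _ := by ring
  have h5 : ‖∑ j ∈ Ico (i + m + 1) (r (k + 1)), coord e j y * coord e i (S (e j))‖ ≤
      ‖S‖ * ∑ j ∈ Ico (i + m + 1) (r (k + 1)), ‖coord e j y‖ := by
    rw [Finset.mul_sum]
    refine norm_sum_le_of_le _ fun j _ => ?_
    rw [norm_mul, mul_comm]
    refine mul_le_mul_of_nonneg_right ?_ (norm_nonneg _)
    refine (norm_coord_le e _ _).trans ((S.le_opNorm _).trans ?_)
    rw [norm_basis, mul_one]
  rw [← norm_mul, eq_neg_of_add_eq_zero_left ((add_assoc _ _ _).symm.trans h1), norm_neg]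
  refine (norm_add_le _ _).trans ((add_le_add h5 h2).trans (le_of_eq ?_))
  ring

/-- If a power series in `T` with leading coefficient at `l = m` maps `y` to a vector supported
below `n`, then `y` is supported below `n + m`.

On a block `r (k + 1) ≤ j < r (k + 2)` with `k` large, the coordinates of `y` are determined by back
substitution from the later ones, whose influence is tiny; so a bound for the coordinates beyond
the block extends to the block. As the coordinates tend to zero, they vanish far out, and then, by
triangularity, down to `n + m`. -/
theorem IsSeries.coord_eq_zero_of_apply (hp : IsAmbroziePair r h) (hε : IsFast r ε)
    (hS : IsSeries e r h ε S a) {m : ℕ} (ha : ∀ l < m, a l = 0) (ham : a m ≠ 0) {n : ℕ} {y : H}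
    (hy : ∀ i, n ≤ i → coord e i (S y) = 0) : ∀ j, n + m ≤ j → coord e j y = 0 := by
  have ham' : 0 < ‖a m‖ := norm_pos_iff.2 ham
  obtain ⟨C, hC⟩ := exists_nat_ge (‖S‖ / ‖a m‖)
  have hblock : ∀ k, C + n + m ≤ k → ∀ M, (∀ j, r (k + 2) ≤ j → ‖coord e j y‖ ≤ M) →
      ∀ j, r (k + 1) ≤ j → ‖coord e j y‖ ≤ M := by
    intro k hk M hM j hj
    rcases Nat.lt_or_ge j (r (k + 2)) with hj2 | hj2
    swap
    · exact hM j hj2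
    have hM0 : 0 ≤ M := (norm_nonneg _).trans (hM _ le_rfl)
    have hpos := hε.pos (k + 1) (by omega)
    have hlt := hε.lt_half (k + 1) (by omega)
    have hg3 := hε.three_le_growth (k + 1)
    set ρ := ‖S‖ / ‖a m‖ / ε (k + 1) with hρ
    set c := 2 * (growth r ε (k + 1) ^ (r (k + 2) + 10))⁻¹ * M with hc
    have hrk : r k + m ≤ r (k + 1) := by
      rcases Nat.eq_zero_or_pos k with rfl | hk0
      · have := hp.strictMono (show 0 < 0 + 1 by omega)
        omega
      · have h4 := hp.four_mul_lt k hk0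
        have h5 := le_r hp k
        omega
    have hrn := le_r hp (k + 1)
    have hρg : 1 + ρ ≤ growth r ε (k + 1) := by
      have h1 := (hε.factors_le_growth (k + 1)).2.2.2.2
      have h2 := hε.two_mul_inv_le_coeffBound k
      have h3 : (C : ℝ) ≤ k := by exact_mod_cast (by omega : C ≤ k)
      have h4 : 1 ≤ (ε (k + 1))⁻¹ := (one_le_inv₀ hpos).2 (by linarith)
      have h5 : ρ ≤ k * (ε (k + 1))⁻¹ := by
        rw [hρ, div_eq_mul_inv]
        exact mul_le_mul_of_nonneg_right (hC.trans h3) (by linarith)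
      push_cast at h1
      have h6 : (0 : ℝ) ≤ k := Nat.cast_nonneg k
      nlinarith
    have hstep : ∀ j, r (k + 1) ≤ j → j < r (k + 2) →
        ‖coord e j y‖ ≤ ρ * (∑ i ∈ Ico (j + 1) (r (k + 2)), ‖coord e i y‖ + c) := by
      intro j h1 h2
      obtain ⟨i, rfl⟩ : ∃ i, j = i + m := ⟨j - m, by omega⟩
      have h3 := hS.mul_coord_le hp hε ha (k := k + 1) (i := i) (hy i (by omega)) hM h2
      rw [hS.coord_basis_diag hp hε ha, norm_mul] at h3
      have h4 := le_norm_op_pow_single_diag (ε := ε) hp hε (k := k) (i := i) (by omega) h1 h2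
      rw [hρ, div_div, div_mul_eq_mul_div, le_div_iff₀ (by positivity)]
      refine le_trans ?_ h3
      gcongr
    have h1 := le_of_le_mul_sum (fun j => norm_nonneg (coord e j y)) (by positivity)
      (by positivity) hstep hj hj2
    refine h1.trans ?_
    have hg0 : 0 < growth r ε (k + 1) ^ (r (k + 2)) := by positivity
    have hg10 : 2 ≤ growth r ε (k + 1) ^ 10 := by
      calc (2 : ℝ) ≤ 3 ^ 10 := by norm_num
        _ ≤ _ := pow_le_pow_left₀ (by norm_num) hg3 _
    calc (1 + ρ) ^ r (k + 2) * c ≤ growth r ε (k + 1) ^ r (k + 2) * c := by gcongr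
      _ = 2 * (growth r ε (k + 1) ^ 10)⁻¹ * M := by
        rw [hc, pow_add]
        field_simp
      _ ≤ 1 * M := by
        refine mul_le_mul_of_nonneg_right ?_ hM0
        rw [← div_eq_mul_inv, div_le_one (by linarith)]
        exact hg10
      _ = M := one_mul M
  have hfar : ∀ j, r (C + n + m + 1) ≤ j → coord e j y = 0 := by
    intro j hj
    rw [← norm_le_zero_iff]
    refine le_of_forall_pos_le_add fun M hM => ?_
    rw [zero_add]
    obtain ⟨K, hK⟩ := eventually_atTop.1 ((tendsto_coord e y).eventually (ge_mem_nhds hM))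
    have hdesc : ∀ t, ∀ j, r (C + n + m + 1 + (K - t)) ≤ j → ‖coord e j y‖ ≤ M := by
      intro t
      induction t with
      | zero =>
        intro j hj
        have := le_r hp (C + n + m + 1 + (K - 0))
        exact hK j (by omega)
      | succ t ih =>
        rcases Nat.lt_or_ge t K with h1 | h1
        · have := hblock (C + n + m + (K - (t + 1))) (by omega) M
          rw [show C + n + m + (K - (t + 1)) + 2 = C + n + m + 1 + (K - t) by omega,
            show C + n + m + (K - (t + 1)) + 1 = C + n + m + 1 + (K - (t + 1)) by omega] at this
          exact this ih
        · rwa [show K - (t + 1) = K - t by omega]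
    exact hdesc K j (by simpa using hj)
  have hall : ∀ t, ∀ j, n + m ≤ j → r (C + n + m + 1) - t ≤ j → coord e j y = 0 := by
    intro t
    induction t with
    | zero => intro j _ hj; exact hfar j hj
    | succ t ih =>
      intro j hj1 hj2
      rcases Nat.lt_or_ge j (r (C + n + m + 1) - t) with h1 | h1
      swap
      · exact ih j hj1 h1
      obtain ⟨i, rfl⟩ : ∃ i, j = i + m := ⟨j - m, by omega⟩
      have hsum := hasSum_coord_apply e S y i
      rw [hy i (by omega)] at hsum
      have h2 := hasSum_single (f := fun j => coord e j y * coord e i (S (e j))) (i + m)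
        fun j hj => by
          rcases hj.lt_or_gt with h3 | h3
          · rw [hS.coord_basis_eq_zero hp hε ha h3, mul_zero]
          · rw [ih j (by omega) (by omega), zero_mul]
      have h3 := hsum.unique h2
      rw [hS.coord_basis_diag hp hε ha] at h3
      have h4 := op_pow_single_diag_ne_zero (ε := ε) hp hε i m
      simpa [ham, h4] using h3.symm
  intro j hj
  exact hall (r (C + n + m + 1)) j hj (by omega)

end

section

variable {H : Type*} [NormedAddCommGroup H] [InnerProductSpace ℂ H]
variable {e : HilbertBasis ℕ ℂ H} {r h : ℕ → ℕ} {ε : ℕ → ℝ} {S B : H →L[ℂ] H} {a : ℕ → ℂ}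
variable {b : ℕ → ℕ → ℂ} {m : ℕ}

/-! ### Matrices with respect to the vectors `u n` -/

/-- The operator `B` has the matrix `b` with respect to the vectors `u n`, which vanishes above
the `m`-th superdiagonal. -/
structure HasBandMatrix (e : HilbertBasis ℕ ℂ H) (r h : ℕ → ℕ) (ε : ℕ → ℝ) (B : H →L[ℂ] H)
    (m : ℕ) (b : ℕ → ℕ → ℂ) : Prop where
  eq_zero : ∀ n i, n + m ≤ i → b n i = 0
  apply_u : ∀ n, B (embed e (u r h ε n)) = ∑ i ∈ range (n + m), b n i • embed e (u r h ε i)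

/-- An operator commuting with a power series in `T` with leading exponent `m ≥ 1` has a banded
matrix: it preserves the kernels of the powers of the series. -/
theorem IsSeries.exists_hasBandMatrix (hp : IsAmbroziePair r h) (hε : IsFast r ε)
    (hS : IsSeries e r h ε S a) (hm : 1 ≤ m) (ha : ∀ l < m, a l = 0) (ham : a m ≠ 0)
    (hB : ∀ y, B (S y) = S (B y)) : ∃ b, HasBandMatrix e r h ε B m b := by
  have hcoord : ∀ n j, n + m ≤ j → coord e j (B (embed e (u r h ε n))) = 0 := by
    intro n
    induction n using Nat.strong_induction_on with
    | _ n ih =>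
      refine hS.coord_eq_zero_of_apply hp hε ha ham fun i hi => ?_
      rw [← hB, hS (n + 1) _ (u_mem_below hp hε (Nat.lt_succ_self n)), map_sum, map_sum]
      refine Finset.sum_eq_zero fun l hl => ?_
      rw [map_smul, map_smul]
      rcases Nat.lt_or_ge l m with h1 | h1
      · rw [ha l h1, zero_smul]
      · have := Finset.mem_range.1 hl
        rw [op_pow_u hp hε, if_pos (by omega), ih (n - l) (by omega) i (by omega), smul_zero]
  choose x hx hxB using fun n => exists_embed_eq e (hcoord n)
  choose b hb0 hb using fun n => exists_sum_u hp hε (n + m) (x n) (hx n)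
  refine ⟨b, hb0, fun n => ?_⟩
  rw [← hxB n]
  conv_lhs => rw [hb n]
  simp only [map_sum, map_smul]

theorem eq_of_sum_embed_u_eq (hp : IsAmbroziePair r h) (hε : IsFast r ε) {N : ℕ} {x y : ℕ → ℂ}
    (hxy : ∑ i ∈ range N, x i • embed e (u r h ε i) = ∑ i ∈ range N, y i • embed e (u r h ε i)) :
    ∀ i < N, x i = y i := by
  simp only [← map_smul, ← map_sum] at hxy
  have h1 := embed_injective e hxy
  rw [← sub_eq_zero, ← Finset.sum_sub_distrib] at h1
  simp only [← sub_smul] at h1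
  exact fun i hi => sub_eq_zero.1
    (eq_zero_of_sum_u_eq_zero hp hε N (fun i => x i - y i) h1 i hi)

theorem IsSeries.apply_u (hp : IsAmbroziePair r h) (hε : IsFast r ε) (hS : IsSeries e r h ε S a)
    {q N : ℕ} (hq : q < N) : S (embed e (u r h ε q)) =
      ∑ i ∈ range N, (if i ≤ q then a (q - i) else 0) • embed e (u r h ε i) := by
  rw [hS (q + 1) _ (u_mem_below hp hε (Nat.lt_succ_self q)),
    ← Finset.sum_subset (Finset.range_subset_range.2 (show q + 1 ≤ N by omega)),
    ← Finset.sum_range_reflect]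
  · refine Finset.sum_congr rfl fun l hl => ?_
    have := Finset.mem_range.1 hl
    rw [op_pow_u hp hε, if_pos (by omega), if_pos (by omega),
      show q + 1 - 1 - l = q - l by omega, show q - (q - l) = l by omega]
  · intro i _ hi
    rw [if_neg (by simpa using hi), zero_smul]

/-- The commutation relation in terms of matrices. -/
theorem HasBandMatrix.comm (hp : IsAmbroziePair r h) (hε : IsFast r ε)
    (hb : HasBandMatrix e r h ε B m b) (hS : IsSeries e r h ε S a)
    (hB : ∀ y, B (S y) = S (B y)) (n i : ℕ) :
    ∑ p ∈ range (n + 1), a (n - p) * b p i =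
      ∑ q ∈ range (n + m), if i ≤ q then a (q - i) * b n q else 0 := by
  rcases Nat.lt_or_ge i (n + m) with hi | hi
  swap
  · rw [Finset.sum_eq_zero, Finset.sum_eq_zero]
    · intro q hq
      have := Finset.mem_range.1 hq
      rw [if_neg (by omega)]
    · intro p hpn
      have := Finset.mem_range.1 hpn
      rw [hb.eq_zero p i (by omega), mul_zero]
  have h1 : B (S (embed e (u r h ε n))) = ∑ i ∈ range (n + m),
      (∑ p ∈ range (n + 1), a (n - p) * b p i) • embed e (u r h ε i) := by
    rw [hS.apply_u hp hε (Nat.lt_succ_self n), map_sum]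
    simp only [Finset.sum_smul]
    rw [Finset.sum_comm]
    refine Finset.sum_congr rfl fun p hpn => ?_
    have hpn' := Finset.mem_range.1 hpn
    rw [map_smul, if_pos (by omega), hb.apply_u, Finset.smul_sum,
      Finset.sum_subset (Finset.range_subset_range.2 (show p + m ≤ n + m by omega))]
    · exact Finset.sum_congr rfl fun i _ => by rw [smul_smul]
    · intro i _ hi
      rw [hb.eq_zero p i (by simpa using hi), zero_smul, smul_zero]
  have h2 : S (B (embed e (u r h ε n))) = ∑ i ∈ range (n + m),
      (∑ q ∈ range (n + m), if i ≤ q then a (q - i) * b n q else 0) • embed e (u r h ε i) := by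
    rw [hb.apply_u, map_sum]
    simp only [Finset.sum_smul]
    rw [Finset.sum_comm]
    refine Finset.sum_congr rfl fun q hq => ?_
    rw [map_smul, hS.apply_u hp hε (Finset.mem_range.1 hq), Finset.smul_sum]
    refine Finset.sum_congr rfl fun i _ => ?_
    rw [smul_smul]
    split_ifs
    · rw [mul_comm]
    · simp
  exact eq_of_sum_embed_u_eq hp hε (h1.symm.trans ((hB _).trans h2)) i hi

/-- The highest nonvanishing superdiagonal is periodic. -/
theorem HasBandMatrix.superdiag_periodic (hp : IsAmbroziePair r h) (hε : IsFast r ε)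
    (hb : HasBandMatrix e r h ε B m b) (hS : IsSeries e r h ε S a)
    (ha : ∀ l < m, a l = 0) (ham : a m ≠ 0) (hB : ∀ y, B (S y) = S (B y)) {p : ℕ}
    (hbp : ∀ n i, n + p < i → b n i = 0) (n : ℕ) :
    b (n + m) (n + m + p) = b n (n + p) := by
  have h1 := hb.comm hp hε hS hB (n + m) (n + p)
  rw [Finset.sum_eq_single n, Finset.sum_eq_single (n + m + p), Nat.add_sub_cancel_left,
    if_pos (by omega), show n + m + p - (n + p) = m by omega] at h1
  · exact (mul_left_cancel₀ ham h1).symm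
  · intro q _ hq
    split_ifs with h2
    · rcases hq.lt_or_gt with h3 | h3
      · rw [ha _ (by omega), zero_mul]
      · rw [hbp _ _ h3, mul_zero]
    · rfl
  · intro hq
    rw [hb.eq_zero _ _ (by simpa using hq), mul_zero, ite_self]
  · intro q hqr hq
    have := Finset.mem_range.1 hqr
    rcases hq.lt_or_gt with h3 | h3
    · rw [hbp q (n + p) (by omega), mul_zero]
    · rw [ha _ (by omega), zero_mul]
  · intro hn
    simp at hn

theorem nonpos_of_forall_exists_mul_le {x C : ℝ} (hx : ∀ N : ℕ, ∃ k : ℕ, N ≤ k ∧ x * k ≤ C) :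
    x ≤ 0 := by
  by_contra! hpos
  obtain ⟨N, hN⟩ := exists_nat_gt (C / x)
  obtain ⟨k, hk, hle⟩ := hx N
  rw [div_lt_iff₀ hpos] at hN
  have : (N : ℝ) ≤ k := by exact_mod_cast hk
  nlinarith

theorem embed_u_pred (hp : IsAmbroziePair r h) (hε : IsFast r ε) (k : ℕ) :
    embed e (u r h ε (r (k + 1) - 1)) = (invProd ε k : ℂ) • e (r (k + 1) - 1) +
      (linkCoeff r h ε (k + 1) : ℂ) • embed e (u r h ε (h (k + 1))) := by
  have hgap := gap hp k
  have h1 := u_block hp hε (k := k) (n := r (k + 1) - 1) (by omega) (by omega)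
  rw [Nat.sub_self, pow_zero, Module.End.one_apply] at h1
  rw [h1, (embed e).map_add, map_smul, map_smul, embed_single]

theorem linkCoeff_mul_norm2 (hp : IsAmbroziePair r h) (hε : IsFast r ε) (k : ℕ) :
    linkCoeff r h ε (k + 1) * C00.norm2 (u r h ε (h (k + 1))) =
      invProd ε (k + 1) * Real.sqrt (ε (k + 1)) := by
  have := one_le_norm2_u hp hε (h (k + 1))
  rw [linkCoeff, mul_assoc, div_mul_cancel₀ _ (by linarith)]

theorem norm_embed_u_pred_le (hp : IsAmbroziePair r h) (hε : IsFast r ε) (k : ℕ) :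
    ‖embed e (u r h ε (r (k + 1) - 1))‖ ≤
      2 * (invProd ε (k + 1) * Real.sqrt (ε (k + 1))) := by
  rw [embed_u_pred hp hε, two_mul]
  refine (norm_add_le _ _).trans (add_le_add ?_ (le_of_eq ?_))
  · rw [norm_smul, norm_basis, mul_one, Complex.norm_real,
      Real.norm_of_nonneg (hε.invProd_pos k).le, ← hε.invProd_succ_mul k]
    exact mul_le_mul_of_nonneg_left (hε.le_sqrt k) (hε.invProd_pos _).le
  · rw [norm_smul, norm_embed, Complex.norm_real, Real.norm_of_nonneg (linkCoeff_pos hp hε k).le,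
      linkCoeff_mul_norm2 hp hε]

theorem eq_of_modEq {α : Type*} {f : ℕ → α} (hf : ∀ i, f (i + m) = f i) {i j : ℕ}
    (hij : i ≡ j [MOD m]) : f i = f j := by
  have hper : Function.Periodic f m := hf
  rw [← hper.map_mod_nat i, ← hper.map_mod_nat j, hij]

/-- Blocks ending in a prescribed residue class, with a prescribed link and arbitrarily far out. -/
theorem exists_block_modEq (hp : IsAmbroziePair r h) {m j : ℕ} (hm : 1 ≤ m) (hj : 1 ≤ j)
    (s N : ℕ) : ∃ k, N ≤ k ∧ h (k + 1) = j ∧ r (k + 1) ≡ s [MOD m] := by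
  obtain ⟨k, ⟨-, hk2, hk3⟩, hk4⟩ :=
    (hp.infinite j m (s % m) hj hm (Nat.mod_lt _ hm)).exists_gt (N + 1)
  obtain ⟨k, rfl⟩ : ∃ k', k = k' + 1 := ⟨k - 1, by omega⟩
  exact ⟨k, by omega, hk2, hk3.trans (Nat.mod_modEq _ _)⟩

/-- There are no entries above the diagonal: by periodicity, such an entry would show up in
`B (u (r k - 1))` for infinitely many `k`, multiplied by `(u (r k))_(r k)`, which is large compared
with the norm of `u (r k - 1)`. -/
theorem HasBandMatrix.eq_zero_of_lt (hp : IsAmbroziePair r h) (hε : IsFast r ε)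
    (hb : HasBandMatrix e r h ε B m b) (hS : IsSeries e r h ε S a) (hm : 1 ≤ m)
    (ha : ∀ l < m, a l = 0) (ham : a m ≠ 0) (hB : ∀ y, B (S y) = S (B y)) :
    ∀ n i, n < i → b n i = 0 := by
  suffices hmain : ∀ t, t ≤ m → ∀ n i, n + (m - t) < i → b n i = 0 by
    simpa using hmain m le_rfl
  intro t
  induction t with
  | zero =>
    intro _ n i hi
    exact hb.eq_zero n i (by omega)
  | succ t ih =>
    intro ht n i hi
    have hbp := ih (by omega)
    rcases Nat.lt_or_ge (n + (m - t)) i with h1 | h1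
    · exact hbp n i h1
    obtain ⟨p, hpt⟩ : ∃ p, m - t = p + 1 := ⟨m - t - 1, by omega⟩
    obtain rfl : i = n + (p + 1) := by omega
    rw [hpt] at hbp
    have hper := hb.superdiag_periodic hp hε hS ha ham hB hbp
    rw [← norm_le_zero_iff]
    refine nonpos_of_forall_exists_mul_le (C := 2 * ‖B‖) fun N => ?_
    obtain ⟨k, hkN, -, hk⟩ := exists_block_modEq hp hm le_rfl (n + 1) (N + m + n + 1)
    have hrk := le_r hp (k + 1)
    have hmod : r (k + 1) - 1 ≡ n [MOD m] := by
      apply Nat.ModEq.add_right_cancel' 1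
      rwa [Nat.sub_add_cancel (by omega)]
    have hentry := eq_of_modEq (f := fun n => b n (n + (p + 1))) (m := m)
      (fun i => by simpa using hper i) hmod
    have hlt := add_lt_r_succ hp (show m < k + 1 by omega)
    have hcoord : coord e (r (k + 1) + p) (B (embed e (u r h ε (r (k + 1) - 1)))) =
        b n (n + (p + 1)) * invProd ε (k + 1) := by
      rw [hb.apply_u, map_sum, Finset.sum_eq_single (r (k + 1) + p)]
      · rw [map_smul, coord_embed, u_apply_self hp hε (k := k + 1) (by omega) (by omega),
          smul_eq_mul, ← hentry, show r (k + 1) - 1 + (p + 1) = r (k + 1) + p by omega]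
      · intro i _ hne
        rw [map_smul, coord_embed]
        rcases hne.lt_or_gt with h3 | h3
        · rw [u_apply_eq_zero hp hε h3, smul_zero]
        · rw [hbp _ _ (by omega), zero_smul]
      · intro hmem
        rw [hb.eq_zero _ _ (by simpa using hmem), zero_smul, map_zero]
    have h3 := (norm_coord_le e (r (k + 1) + p) _).trans
      ((B.le_opNorm _).trans (mul_le_mul_of_nonneg_left (norm_embed_u_pred_le (e := e) hp hε k)
        (norm_nonneg B)))
    have hA := hε.invProd_pos (k + 1)
    rw [hcoord, norm_mul, Complex.norm_real, Real.norm_of_nonneg hA.le] at h3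
    have h4 : ‖b n (n + (p + 1))‖ ≤ 2 * ‖B‖ * Real.sqrt (ε (k + 1)) := by
      refine le_of_mul_le_mul_right (h3.trans (le_of_eq ?_)) hA
      ring
    have h5 := hε.sqrt_mul_pow_le k (p := 1) (q := 0) (by omega)
    rw [pow_one, pow_zero, inv_one] at h5
    have h6 := (hε.factors_le_growth k).1
    refine ⟨k, by omega, ?_⟩
    have h7 : (0 : ℝ) ≤ k := Nat.cast_nonneg k
    have h8 : Real.sqrt (ε (k + 1)) * k ≤ 1 :=
      (mul_le_mul_of_nonneg_left (by linarith) (Real.sqrt_nonneg _)).trans h5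
    calc ‖b n (n + (p + 1))‖ * k ≤ 2 * ‖B‖ * Real.sqrt (ε (k + 1)) * k := by gcongr
      _ = 2 * ‖B‖ * (Real.sqrt (ε (k + 1)) * k) := by ring
      _ ≤ 2 * ‖B‖ := mul_le_of_le_one_right (by positivity) h8

end

section

variable {H : Type*} [NormedAddCommGroup H] [InnerProductSpace ℂ H]
variable {e : HilbertBasis ℕ ℂ H} {r h : ℕ → ℕ} {ε : ℕ → ℝ} {S B : H →L[ℂ] H} {a : ℕ → ℂ}
variable {b : ℕ → ℕ → ℂ} {m : ℕ}

/-! ### The diagonals of a commuting operator -/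

/-- The commutation relation for a triangular matrix, in terms of its diagonals
`d ↦ b (i + d) i`. -/
theorem HasBandMatrix.diag_relation (hp : IsAmbroziePair r h) (hε : IsFast r ε)
    (hb : HasBandMatrix e r h ε B m b) (hS : IsSeries e r h ε S a) (hm : 1 ≤ m)
    (ha : ∀ l < m, a l = 0) (hB : ∀ y, B (S y) = S (B y)) (hb0 : ∀ n i, n < i → b n i = 0)
    (d i : ℕ) :
    ∑ t ∈ range (d + 1),
      a (m + t) * (b (i + (d - t)) i - b (i + m + t + (d - t)) (i + m + t)) = 0 := by
  have h1 := hb.comm hp hε hS hB (i + d + m) i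
  have h2 : ∑ p ∈ range (i + d + m + 1), a (i + d + m - p) * b p i =
      ∑ t ∈ range (d + 1), a (m + t) * b (i + (d - t)) i := by
    rw [show i + d + m + 1 = i + (d + 1) + m by omega, Finset.sum_range_add, Finset.sum_range_add,
      Finset.sum_eq_zero, zero_add, add_eq_left.2, ← Finset.sum_range_reflect]
    · refine Finset.sum_congr rfl fun t ht => ?_
      have := Finset.mem_range.1 ht
      rw [show d + 1 - 1 - t = d - t by omega, show i + d + m - (i + (d - t)) = m + t by omega]
    · refine Finset.sum_eq_zero fun q hq => ?_
      have := Finset.mem_range.1 hq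
      rw [ha _ (by omega), zero_mul]
    · intro p hpi
      rw [hb0 p i (by simpa using hpi), mul_zero]
  have h3 : ∑ q ∈ range (i + d + m + m),
      (if i ≤ q then a (q - i) * b (i + d + m) q else 0) =
      ∑ t ∈ range (d + 1), a (m + t) * b (i + m + t + (d - t)) (i + m + t) := by
    rw [show i + d + m + m = i + m + (d + 1) + (m - 1) by omega, Finset.sum_range_add,
      Finset.sum_range_add, Finset.sum_eq_zero, zero_add, add_eq_left.2]
    · refine Finset.sum_congr rfl fun t ht => ?_
      have := Finset.mem_range.1 ht
      rw [if_pos (by omega), show i + m + t - i = m + t by omega,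
        show i + m + t + (d - t) = i + d + m by omega]
    · refine Finset.sum_eq_zero fun q _ => ?_
      rw [hb0 _ _ (by omega), mul_zero, ite_self]
    · intro q hq
      have := Finset.mem_range.1 hq
      split_ifs
      · rw [ha _ (by omega), zero_mul]
      · rfl
  rw [h2, h3, ← sub_eq_zero, ← Finset.sum_sub_distrib] at h1
  simpa only [← mul_sub] using h1


/-- The recursion for the diagonals propagates a bound `M`, valid in the range
`R ≤ i ≤ R + m + D`, downwards to all smaller `i`, at an exponential cost. -/
theorem norm_diag_le {f : ℕ → ℕ → ℂ} {m R D : ℕ} {C M : ℝ} (hC : 0 ≤ C) (hM : 0 ≤ M)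
    (ham : a m ≠ 0) (haC : ∀ t, ‖a (m + t)‖ ≤ C * ‖a m‖)
    (hrel : ∀ d i, ∑ t ∈ range (d + 1), a (m + t) * (f (d - t) i - f (d - t) (i + m + t)) = 0)
    (hm : 1 ≤ m) (hf : ∀ d i, d ≤ D → R ≤ i → i ≤ R + m + D → ‖f d i‖ ≤ M) (w : ℕ) :
    ∀ d i, (R - i) + d ≤ w → d ≤ D → i ≤ R + m + D → ‖f d i‖ ≤ M * (1 + 2 * C * D) ^ w := by
  have hK : 1 ≤ 1 + 2 * C * D := by
    have : (0 : ℝ) ≤ 2 * C * D := by positivity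
    linarith
  -- The induction is on `w ≥ (R - i) + d` (truncated subtraction), which decreases in each term of
  -- the recursion as long as `i < R`.
  have hbase : ∀ w d i, d ≤ D → R ≤ i → i ≤ R + m + D → ‖f d i‖ ≤ M * (1 + 2 * C * D) ^ w :=
    fun w d i h1 h2 h3 => (hf d i h1 h2 h3).trans
      (le_mul_of_one_le_right hM (one_le_pow₀ hK))
  induction w with
  | zero =>
    intro d i hw hd hi
    exact hbase 0 d i hd (by omega) hi
  | succ w ih =>
    intro d i hw hd hi
    rcases Nat.lt_or_ge i R with hiR | hiR
    swap
    · exact hbase _ d i hd hiR hi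
    have ham' : 0 < ‖a m‖ := norm_pos_iff.2 ham
    have h1 := hrel d i
    rw [Finset.sum_range_succ'] at h1
    simp only [Nat.sub_zero, add_zero] at h1
    set X := M * (1 + 2 * C * D) ^ w with hX
    have hX0 : 0 ≤ X := by positivity
    have h2 : ‖∑ t ∈ range d, a (m + (t + 1)) *
        (f (d - (t + 1)) i - f (d - (t + 1)) (i + m + (t + 1)))‖ ≤ d * (C * ‖a m‖ * (X + X)) := by
      rw [← nsmul_eq_mul, ← Finset.card_range d, ← Finset.sum_const, Finset.card_range]
      refine norm_sum_le_of_le _ fun t ht => ?_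
      have := Finset.mem_range.1 ht
      rw [norm_mul]
      refine mul_le_mul (haC _) ((norm_sub_le _ _).trans (add_le_add ?_ ?_)) (norm_nonneg _)
        (by positivity)
      · exact ih _ _ (by omega) (by omega) hi
      · exact ih _ _ (by omega) (by omega) (by omega)
    have h3 := ih d (i + m) (by omega) hd (by omega)
    have h4 : ‖a m‖ * ‖f d i - f d (i + m)‖ ≤ d * (C * ‖a m‖ * (X + X)) := by
      rw [← norm_mul, eq_neg_of_add_eq_zero_right h1, norm_neg]
      exact h2
    have h5 : ‖f d i - f d (i + m)‖ ≤ D * (C * (X + X)) := by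
      refine le_of_mul_le_mul_left (h4.trans ?_) ham'
      have hdD : (d : ℝ) ≤ D := by exact_mod_cast hd
      calc (d : ℝ) * (C * ‖a m‖ * (X + X)) ≤ D * (C * ‖a m‖ * (X + X)) := by gcongr
        _ = _ := by ring
    calc ‖f d i‖ = ‖(f d i - f d (i + m)) + f d (i + m)‖ := by rw [sub_add_cancel]
      _ ≤ D * (C * (X + X)) + X := (norm_add_le _ _).trans (add_le_add h5 h3)
      _ = _ := by rw [hX, pow_succ]; ring

theorem HasBandMatrix.apply_u_range (hb : HasBandMatrix e r h ε B m b)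
    (hb0 : ∀ n i, n < i → b n i = 0) (hm : 1 ≤ m) (n : ℕ) :
    B (embed e (u r h ε n)) = ∑ i ∈ range (n + 1), b n i • embed e (u r h ε i) := by
  rw [hb.apply_u, ← Finset.sum_subset (Finset.range_subset_range.2 (show n + 1 ≤ n + m by omega))]
  intro i _ hi
  rw [hb0 n i (by simpa using hi), zero_smul]

theorem HasBandMatrix.coord_apply_u (hb : HasBandMatrix e r h ε B m b)
    (hb0 : ∀ n i, n < i → b n i = 0) (hm : 1 ≤ m) (n c : ℕ) :
    coord e c (B (embed e (u r h ε n))) = ∑ i ∈ range (n + 1), b n i * u r h ε i c := by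
  rw [hb.apply_u_range hb0 hm, map_sum]
  simp only [map_smul, coord_embed, smul_eq_mul]

/-- Where the vectors `u n` are multiples of basis vectors, with the same factor, the matrix
entries are bounded by the norm of the operator. -/
theorem HasBandMatrix.norm_le (hp : IsAmbroziePair r h) (hε : IsFast r ε)
    (hb : HasBandMatrix e r h ε B m b) (hb0 : ∀ n i, n < i → b n i = 0) (hm : 1 ≤ m)
    {k n i : ℕ} (hi : r k ≤ i) (hin : i ≤ n) (hn : n + h (k + 1) + 1 < r (k + 1)) :
    ‖b n i‖ ≤ ‖B‖ := by
  have hA := hε.invProd_pos k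
  have h1 := hb.coord_apply_u hb0 hm n i
  rw [Finset.sum_eq_single i, u_apply_self hp hε hi (by omega),
    u_block_of_lt hp hε (by omega) hn, map_smul, embed_single, map_smul, map_smul, smul_eq_mul,
    mul_comm] at h1
  · have h2 : b n i = coord e i (B (e n)) :=
      (mul_right_cancel₀ (by exact_mod_cast hA.ne') h1).symm
    rw [h2]
    refine (norm_coord_le e _ _).trans ((B.le_opNorm _).trans ?_)
    rw [norm_basis, mul_one]
  · intro q hq hne
    have := Finset.mem_range.1 hq
    rcases hne.lt_or_gt with h3 | h3
    · rw [u_apply_eq_zero hp hε h3, mul_zero]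
    · rw [u_block_of_lt hp hε (k := k) (by omega) (by omega), Finsupp.smul_apply,
        Finsupp.single_apply, if_neg (by omega), smul_zero, mul_zero]
  · intro hmem
    simp at hmem
    omega

/-- The vector `u (r (k + 1) - 1)` is, up to a small error, a multiple of `u j`, where
`j = h (k + 1)`. Applying `B` and reading off a coordinate shows that the diagonals of `B` have
almost the same entries in the columns of `u (r (k + 1) - 1)` and `u j`. -/
theorem HasBandMatrix.norm_diag_sub_le (hp : IsAmbroziePair r h) (hε : IsFast r ε)
    (hb : HasBandMatrix e r h ε B m b) (hb0 : ∀ n i, n < i → b n i = 0) (hm : 1 ≤ m)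
    {k d c : ℕ} (hj : h (k + 1) = c + d) (hk : 1 ≤ k)
    (hconst : ∀ d' < d, ∀ i i', b (i + d') i = b (i' + d') i') {X : ℝ}
    (hX : ∀ i < r k, ‖b (r (k + 1) - 1) i‖ ≤ X) :
    ‖b (r (k + 1) - 1) (r (k + 1) - 1 - d) - b (c + d) c‖ * linkCoeff r h ε (k + 1) ≤
      invProd ε k * ‖B‖ + r k * (X * coeffBound ε k) := by
  set N := r (k + 1) - 1 with hN
  set β := linkCoeff r h ε (k + 1) with hβ
  have hgap := gap hp k
  have hkr := self_lt_r hp k hk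
  have hhk := h_succ_le hp k
  have hX0 : 0 ≤ X := (norm_nonneg _).trans (hX 0 (by omega))
  have hB1 := hε.one_le_coeffBound k
  -- The coordinate `c` of `B (u N)`, computed from the matrix.
  have h1 : coord e c (B (embed e (u r h ε N))) = ∑ i ∈ range (r k), b N i * u r h ε i c +
      β * ∑ t ∈ range (c + d + 1), b N (N - t) * u r h ε (c + d - t) c := by
    rw [hb.coord_apply_u hb0 hm, show N + 1 = r k + (N + 1 - r k) by omega, Finset.sum_range_add,
      ← Finset.sum_range_reflect _ (N + 1 - r k), Finset.mul_sum,
      ← Finset.sum_subset (Finset.range_subset_range.2 (show c + d + 1 ≤ N + 1 - r k by omega))]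
    · congr 1
      refine Finset.sum_congr rfl fun t ht => ?_
      have := Finset.mem_range.1 ht
      rw [show r k + (N + 1 - r k - 1 - t) = N - t by omega,
        u_block hp hε (k := k) (n := N - t) (by omega) (by omega), op_pow_u hp hε, hj,
        show r (k + 1) - 1 - (N - t) = t by omega, if_pos (by omega), Finsupp.add_apply,
        Finsupp.smul_apply, Finsupp.smul_apply, Finsupp.single_apply, if_neg (by omega), smul_zero,
        zero_add, smul_eq_mul]
      ring
    · intro t ht1 ht2
      have := Finset.mem_range.1 ht1
      have : ¬ t < c + d + 1 := fun hcon => ht2 (Finset.mem_range.2 hcon)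
      rw [show r k + (N + 1 - r k - 1 - t) = N - t by omega,
        u_block_of_lt hp hε (k := k) (n := N - t) (by omega) (by omega),
        Finsupp.smul_apply, Finsupp.single_apply, if_neg (by omega), smul_zero, mul_zero]
  have h2 : coord e c (B (embed e (u r h ε (c + d)))) =
      ∑ t ∈ range (c + d + 1), b (c + d) (c + d - t) * u r h ε (c + d - t) c := by
    rw [hb.coord_apply_u hb0 hm, ← Finset.sum_range_reflect]
    refine Finset.sum_congr rfl fun t _ => ?_
    rw [show c + d + 1 - 1 - t = c + d - t by omega]
  have h3 : coord e c (B (embed e (u r h ε N))) =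
      invProd ε k * coord e c (B (e N)) + β * coord e c (B (embed e (u r h ε (c + d)))) := by
    rw [embed_u_pred hp hε, hj]
    simp only [map_add, map_smul, smul_eq_mul, ← hN, ← hβ]
  have h4 : ∑ t ∈ range (c + d + 1),
      (b N (N - t) - b (c + d) (c + d - t)) * u r h ε (c + d - t) c =
      (b N (N - d) - b (c + d) c) * u r h ε c c := by
    rw [Finset.sum_eq_single d, Nat.add_sub_cancel]
    · intro t ht hne
      have := Finset.mem_range.1 ht
      rcases hne.lt_or_gt with h5 | h5
      · have h6 := hconst t h5 (N - t) (c + d - t)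
        rw [Nat.sub_add_cancel (by omega), Nat.sub_add_cancel (by omega)] at h6
        rw [h6, sub_self, zero_mul]
      · rw [u_apply_eq_zero hp hε (by omega), mul_zero]
    · intro hmem
      simp at hmem
  have h5 : (β : ℂ) * ((b N (N - d) - b (c + d) c) * u r h ε c c) =
      invProd ε k * coord e c (B (e N)) - ∑ i ∈ range (r k), b N i * u r h ε i c := by
    rw [← h4]
    simp only [sub_mul, Finset.sum_sub_distrib]
    rw [mul_sub, ← h2]
    linear_combination h3 - h1
  have hβ0 : 0 < β := linkCoeff_pos hp hε k
  calc ‖b N (N - d) - b (c + d) c‖ * β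
      ≤ ‖b N (N - d) - b (c + d) c‖ * β * ‖u r h ε c c‖ :=
        le_mul_of_one_le_right (by positivity) (one_le_norm_u_apply_self hp hε c)
    _ = ‖(β : ℂ) * ((b N (N - d) - b (c + d) c) * u r h ε c c)‖ := by
        rw [norm_mul, norm_mul, Complex.norm_real, Real.norm_of_nonneg hβ0.le]
        ring
    _ ≤ _ := by
        rw [h5]
        refine (norm_sub_le _ _).trans (add_le_add ?_ ?_)
        · rw [norm_mul, Complex.norm_real, Real.norm_of_nonneg (hε.invProd_pos k).le]
          refine mul_le_mul_of_nonneg_left ?_ (hε.invProd_pos k).le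
          refine (norm_coord_le e _ _).trans ((B.le_opNorm _).trans ?_)
          rw [norm_basis, mul_one]
        · rw [← nsmul_eq_mul, ← Finset.card_range (r k), ← Finset.sum_const, Finset.card_range]
          refine norm_sum_le_of_le _ fun i hi => ?_
          have := Finset.mem_range.1 hi
          rw [norm_mul]
          exact mul_le_mul (hX i this) (norm_u_apply_le hp hε k i c this.le) (norm_nonneg _) hX0

/-- The matrix of an operator commuting with a nonscalar power series in `T` is constant along the
diagonals. -/
theorem HasBandMatrix.diag_const (hp : IsAmbroziePair r h) (hε : IsFast r ε)
    (hb : HasBandMatrix e r h ε B m b) (hS : IsSeries e r h ε S a) (hm : 1 ≤ m)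
    (ha : ∀ l < m, a l = 0) (ham : a m ≠ 0) (hB : ∀ y, B (S y) = S (B y)) (d : ℕ) :
    ∀ i i', b (i + d) i = b (i' + d) i' := by
  have hb0 := hb.eq_zero_of_lt hp hε hS hm ha ham hB
  have hrel := hb.diag_relation hp hε hS hm ha hB hb0
  induction d using Nat.strong_induction_on with
  | _ d ih =>
    have hper : ∀ i, b (i + m + d) (i + m) = b (i + d) i := by
      intro i
      have h1 := hrel d i
      rw [Finset.sum_range_succ', Finset.sum_eq_zero, zero_add] at h1
      · simpa [ham, sub_eq_zero, eq_comm] using h1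
      · intro t ht
        have := Finset.mem_range.1 ht
        rw [ih (d - (t + 1)) (by omega) i (i + m + (t + 1)), sub_self, mul_zero]
    -- All residue classes agree with the one of `1`.
    suffices hone : ∀ s, b (s + d) s = b (1 + d) 1 from fun i i' => (hone i).trans (hone i').symm
    intro s
    have ham' : 0 < ‖a m‖ := norm_pos_iff.2 ham
    obtain ⟨C, hC⟩ := exists_nat_ge (‖S‖ / ‖a m‖)
    rw [div_le_iff₀ ham'] at hC
    have haC : ∀ t, ‖a (m + t)‖ ≤ C * ‖a m‖ := fun t => (hS.norm_coeff_le hp hε _).trans hC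
    rw [← sub_eq_zero, ← norm_le_zero_iff]
    refine nonpos_of_forall_exists_mul_le
      (C := C00.norm2 (u r h ε (1 + d)) * ‖B‖) fun K => ?_
    obtain ⟨k, hkK, hkj, hks⟩ := exists_block_modEq hp hm (show 1 ≤ 1 + d by omega) (s + d + 1)
      (K + 2 * C + m + d + 2)
    refine ⟨k, by omega, ?_⟩
    have hrk := le_r hp k
    have hkr := le_r hp (k + 1)
    have h4k := hp.four_mul_lt k (by omega)
    have h4k' := hp.four_mul_lt (k + 1) (by omega)
    have hhk := h_succ_le hp (k + 1)
    set N := r (k + 1) - 1 with hN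
    have hmod : N - d ≡ s [MOD m] := by
      apply Nat.ModEq.add_right_cancel' (d + 1)
      rwa [show N - d + (d + 1) = r (k + 1) by omega]
    have hs := eq_of_modEq (f := fun i => b (i + d) i) hper hmod
    rw [← hs, Nat.sub_add_cancel (by omega)]
    -- A crude bound for the entries `b N i`, obtained from those further out.
    have hX : ∀ i < r k, ‖b N i‖ ≤ ‖B‖ * (1 + 2 * C * r (k + 1)) ^ (2 * r (k + 1)) := by
      intro i hi
      have := norm_diag_le (a := a) (f := fun d i => b (i + d) i) (R := r (k + 1))
        (D := r (k + 1)) (M := ‖B‖) (Nat.cast_nonneg C) (norm_nonneg _) ham haC hrel hm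
        (fun d i h1 h2 h3 => hb.norm_le hp hε hb0 hm (k := k + 1) h2 (by omega)
          (by omega)) (2 * r (k + 1)) (N - i) i (by omega) (by omega)
        (by omega)
      rwa [show i + (N - i) = N by omega] at this
    have hmain := hb.norm_diag_sub_le hp hε hb0 hm (k := k) (c := 1) hkj (by omega) ih hX
    rw [← hN] at hmain
    set Δ := ‖b N (N - d) - b (1 + d) 1‖ with hΔ
    set L := growth r ε k with hL
    set q := C00.norm2 (u r h ε (1 + d)) with hq
    have hq0 : 0 ≤ q := zero_le_one.trans (one_le_norm2_u hp hε _)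
    have hL3 : 3 ≤ L := hε.three_le_growth k
    obtain ⟨hL1, hL2, hLU, hLk, -⟩ := hε.factors_le_growth k
    have hrr : (r (k + 1) : ℝ) ≤ r (k + 2) := by
      exact_mod_cast hp.strictMono.monotone (by omega)
    have hCk : 2 * (C : ℝ) ≤ k := by exact_mod_cast (by omega : 2 * C ≤ k)
    have hk0 : (0 : ℝ) ≤ k := Nat.cast_nonneg k
    have hr0 : (0 : ℝ) ≤ r (k + 1) := Nat.cast_nonneg _
    have hbase : 1 + 2 * C * r (k + 1) ≤ L := by
      refine le_trans ?_ hLk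
      nlinarith
    have hrkL : (r k : ℝ) ≤ L := by
      refine le_trans ?_ hL2
      have : (r k : ℝ) ≤ r (k + 2) := by exact_mod_cast hp.strictMono.monotone (by omega)
      linarith
    have hA1 := hε.one_le_invProd k
    have hU1 := hε.one_le_coeffBound k
    have hAL : invProd ε k ≤ L := (hε.invProd_le_coeffBound k).trans hLU
    have hlink : 1 ≤ linkCoeff r h ε (k + 1) * (q * Real.sqrt (ε (k + 1))) := by
      have h1 := linkCoeff_mul_norm2 hp hε k
      rw [hkj, ← hq] at h1
      rw [← mul_assoc, h1, mul_assoc, Real.mul_self_sqrt (hε.pos _ (by omega)).le,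
        hε.invProd_succ_mul]
      exact hA1
    have hpow1 : L ≤ L ^ (2 * r (k + 1) + 2) := le_self_pow₀ (by linarith) (by omega)
    have hrhs : invProd ε k * ‖B‖ + r k * (‖B‖ * (1 + 2 * C * r (k + 1)) ^ (2 * r (k + 1)) *
        coeffBound ε k) ≤ ‖B‖ * L ^ (2 * r (k + 1) + 3) := by
      calc _ ≤ L * ‖B‖ + L * (‖B‖ * L ^ (2 * r (k + 1)) * L) := by gcongr
        _ = ‖B‖ * (L + L ^ (2 * r (k + 1) + 2)) := by ring
        _ ≤ ‖B‖ * (L * L ^ (2 * r (k + 1) + 2)) := by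
            refine mul_le_mul_of_nonneg_left ?_ (norm_nonneg _)
            nlinarith
        _ = _ := by ring
    have hsq := hε.sqrt_mul_pow_le k (p := 2 * r (k + 1) + 3 + 1) (q := 0) (by omega)
    rw [← hL, pow_zero, inv_one, pow_succ, ← mul_assoc] at hsq
    calc Δ * k ≤ Δ * (linkCoeff r h ε (k + 1) * (q * Real.sqrt (ε (k + 1)))) * L := by
          refine mul_le_mul (le_mul_of_one_le_right (norm_nonneg _) hlink) (by linarith) hk0 ?_
          exact mul_nonneg (norm_nonneg _) (zero_le_one.trans hlink)
      _ = (Δ * linkCoeff r h ε (k + 1)) * (q * Real.sqrt (ε (k + 1)) * L) := by ring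
      _ ≤ (‖B‖ * L ^ (2 * r (k + 1) + 3)) * (q * Real.sqrt (ε (k + 1)) * L) := by
          refine mul_le_mul_of_nonneg_right (hmain.trans hrhs) (by positivity)
      _ = q * ‖B‖ * (Real.sqrt (ε (k + 1)) * L ^ (2 * r (k + 1) + 3) * L) := by ring
      _ ≤ q * ‖B‖ := mul_le_of_le_one_right (by positivity) hsq

/-- An operator commuting with a nonscalar power series in `T` without constant term is itself a
power series in `T`. -/
theorem IsSeries.isSeries_of_comm (hp : IsAmbroziePair r h) (hε : IsFast r ε)
    (hS : IsSeries e r h ε S a) (hm : 1 ≤ m) (ha : ∀ l < m, a l = 0) (ham : a m ≠ 0)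
    (hB : ∀ y, B (S y) = S (B y)) : ∃ c, IsSeries e r h ε B c := by
  obtain ⟨b, hb⟩ := hS.exists_hasBandMatrix hp hε hm ha ham hB
  have hb0 := hb.eq_zero_of_lt hp hε hS hm ha ham hB
  refine ⟨fun d => b (0 + d) 0, isSeries_of_u hp hε fun n => ?_⟩
  rw [hb.apply_u_range hb0 hm, ← Finset.sum_range_reflect]
  refine Finset.sum_congr rfl fun l hl => ?_
  have := Finset.mem_range.1 hl
  rw [show n + 1 - 1 - l = n - l by omega,
    hb.diag_const hp hε hS hm ha ham hB l 0 (n - l), Nat.sub_add_cancel (by omega)]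

end

section

variable {H : Type*} [NormedAddCommGroup H] [InnerProductSpace ℂ H]
variable {e : HilbertBasis ℕ ℂ H} {r h : ℕ → ℕ} {ε : ℕ → ℝ} {S B : H →L[ℂ] H} {a c : ℕ → ℂ}

/-! ### Consequences for commutants -/

theorem IsSeries.comm (hS : IsSeries e r h ε S a) (hB : IsSeries e r h ε B c)
    (hp : IsAmbroziePair r h) (hε : IsFast r ε) (y : H) : B (S y) = S (B y) := by
  suffices hBS : B ∘L S = S ∘L B from DFunLike.congr_fun hBS y
  refine eq_of_embed e fun x => ?_
  obtain ⟨N, hN⟩ := exists_mem_below x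
  have hmem : ∀ l, (op r h ε ^ l) x ∈ below N := fun l =>
    op_pow_mem_below hp hε (by omega) hN
  rw [ContinuousLinearMap.comp_apply, ContinuousLinearMap.comp_apply, hS N x hN, hB N x hN,
    map_sum, map_sum]
  simp only [map_smul]
  simp_rw [hB N _ (hmem _), hS N _ (hmem _), Finset.smul_sum]
  rw [Finset.sum_comm]
  refine Finset.sum_congr rfl fun l _ => Finset.sum_congr rfl fun l' _ => ?_
  rw [smul_comm, ← Module.End.mul_apply, ← Module.End.mul_apply, ← pow_add, ← pow_add,
    add_comm l l']

theorem IsSeries.eq_smul_id (hS : IsSeries e r h ε S a) (ha : ∀ l, 1 ≤ l → a l = 0) :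
    S = a 0 • ContinuousLinearMap.id ℂ H := by
  refine eq_of_basis e fun j => ?_
  rw [← embed_single, hS (j + 1) _ (single_mem_below (Nat.lt_succ_self j)), Finset.sum_range_succ',
    Finset.sum_eq_zero fun l _ => by rw [ha _ (by omega), zero_smul]]
  simp

theorem IsSeries.sub_const (hS : IsSeries e r h ε S a) :
    IsSeries e r h ε (S - a 0 • ContinuousLinearMap.id ℂ H)
      (fun l => if l = 0 then 0 else a l) := by
  intro N x hx
  rcases N with _ | N
  · have : x = 0 := by
      ext i
      exact mem_below.1 hx i (Nat.zero_le _)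
    simp [this]
  · rw [sub_apply, hS (N + 1) x hx, Finset.sum_range_succ',
      Finset.sum_range_succ']
    simp

theorem exists_isSeries_of_mem_commutant (hp : IsAmbroziePair r h) (hε : IsFast r ε)
    {T : H →L[ℂ] H} (hT : ExtendsOp e (op r h ε) T) (hS : S ∈ commutant T) :
    ∃ a, IsSeries e r h ε S a :=
  (isSeries_extension hp hε hT).isSeries_of_comm hp hε le_rfl
    (fun l hl => by rw [if_neg (by omega)]) (by simp)
    fun y => (DFunLike.congr_fun (show T ∘L S = S ∘L T from hS) y).symm

theorem commutant_eq (hp : IsAmbroziePair r h) (hε : IsFast r ε) {T : H →L[ℂ] H}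
    (hT : ExtendsOp e (op r h ε) T) (hS : S ∈ commutant T) (hns : S ∈ nonScalar H) :
    commutant S = commutant T := by
  obtain ⟨a, ha⟩ := exists_isSeries_of_mem_commutant hp hε hT hS
  have hTs := isSeries_extension hp hε hT
  have hex : ∃ l, 1 ≤ l ∧ a l ≠ 0 := by
    by_contra! hcon
    exact hns _ (ha.eq_smul_id hcon)
  classical
  obtain ⟨hm, ham⟩ := Nat.find_spec hex
  have hlt : ∀ l < Nat.find hex, (if l = 0 then 0 else a l) = 0 := fun l hl => by
    split_ifs with h0
    · rfl
    · by_contra hne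
      exact Nat.find_min hex hl ⟨by omega, hne⟩
  ext B
  constructor
  · intro hB
    have hB' : ∀ y, S (B y) = B (S y) := DFunLike.congr_fun (show S ∘L B = B ∘L S from hB)
    obtain ⟨c, hc⟩ := ha.sub_const.isSeries_of_comm hp hε hm hlt
      (by rw [if_neg (by omega)]; exact ham)
      (B := B) (fun y => by simp [hB' y])
    ext y
    exact hc.comm hTs hp hε y
  · intro hB
    obtain ⟨c, hc⟩ := exists_isSeries_of_mem_commutant hp hε hT hB
    ext y
    exact hc.comm ha hp hε y

/-- A compact power series in `T` vanishes: it maps `e (r k + l)`, a weakly null sequence, to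
vectors whose coordinate at `r k` is the `l`-th coefficient of the series. -/
theorem IsSeries.eq_zero_of_isCompactOperator (hp : IsAmbroziePair r h) (hε : IsFast r ε)
    (hS : IsSeries e r h ε S a) (hc : IsCompactOperator S) : S = 0 := by
  have ha : ∀ l, a l = 0 := by
    intro l
    obtain ⟨C, hC, hCS⟩ := IsCompactOperator.image_closedBall_subset_compact
      (f := (S : H →ₗ[ℂ] H)) hc 1
    have hmem : ∀ k, S (e (r (k + l + 1) + l)) ∈ C := fun k =>
      hCS ⟨_, by simp [norm_basis], rfl⟩
    obtain ⟨z, -, φ, hφ, hlim⟩ := hC.tendsto_subseq hmem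
    have h1 : Tendsto (fun n => r (φ n + l + 1)) atTop atTop :=
      hp.strictMono.tendsto_atTop.comp
        (tendsto_atTop_mono (fun n => by omega) hφ.tendsto_atTop)
    have h2 := (tendsto_coord e z).comp h1
    have h3 := (tendsto_iff_norm_sub_tendsto_zero.1 hlim).add h2
    rw [add_zero] at h3
    rw [← norm_le_zero_iff]
    refine ge_of_tendsto' h3 fun n => ?_
    rw [← hS.coord_basis_eq hp hε (k := φ n + l + 1) (l := l) (add_lt_r_succ hp (by omega))]
    calc _ = ‖coord e (r (φ n + l + 1)) (S (e (r (φ n + l + 1) + l)) - z) +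
          coord e (r (φ n + l + 1)) z‖ := by rw [map_sub, sub_add_cancel]
      _ ≤ _ := (norm_add_le _ _).trans (add_le_add_left (norm_coord_le e _ _) _)
  rw [hS.eq_smul_id fun l _ => ha l, ha 0, zero_smul]

/-! ### Bounds for fast decreasing sequences -/

theorem coeffBound_congr {ε ε' : ℕ → ℝ} {k : ℕ} (hεε : ∀ i, 1 ≤ i → i ≤ k → ε i = ε' i) :
    coeffBound ε k = coeffBound ε' k := by
  unfold coeffBound invProd
  refine Finset.prod_congr rfl fun i hi => ?_
  have hi' := Finset.mem_Icc.1 hi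
  congr 2
  refine Finset.prod_congr rfl fun j hj => ?_
  have hj' := Finset.mem_Icc.1 hj
  exact hεε j hj'.1 (hj'.2.trans hi'.2)

theorem growth_pos {k : ℕ} (hpos : ∀ i, 1 ≤ i → 0 < ε i) : 0 < growth r ε k := by
  have h1 : 0 < coeffBound ε k := Finset.prod_pos fun i _ => mul_pos two_pos
    (inv_pos.2 (Finset.prod_pos fun j hj => hpos j (Finset.mem_Icc.1 hj).1))
  unfold growth
  positivity

theorem holdsForFastDecreasing_of_isFast (r : ℕ → ℕ) {P : (ℕ → ℝ) → Prop}
    (hP : ∀ ε, IsFast r ε → P ε) : HoldsForFastDecreasing P := by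
  classical
  -- A finite sequence `ε 1, …, ε k`, indexed from `0`, continued by the value `1`.
  let ext : (k : ℕ) → (Fin k → ℝ) → ℕ → ℝ := fun k a i =>
    if hi : i - 1 < k then a ⟨i - 1, hi⟩ else 1
  let G : (k : ℕ) → (Fin k → ℝ) → ℝ := fun k a =>
    growth r (ext k a) k ^ (8 * r (k + 1) + 20)
  refine ⟨fun k a => if 0 < G k a then (G k a)⁻¹ ^ 2 else 1, fun k a => ?_, fun ε h1 h2 => ?_⟩
  · simp only
    split_ifs with hG
    · positivity
    · exact one_pos
  · refine hP ε ⟨fun k hk => (h1 k hk).1, fun k hk => (h1 k hk).2.1, fun k => ?_⟩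
    have hgrow : growth r (ext k fun i => ε (i + 1)) k = growth r ε k := by
      unfold growth
      rw [coeffBound_congr fun i hi hik => ?_]
      simp only [ext]
      rw [dif_pos (by omega)]
      rw [Nat.sub_add_cancel hi]
    have hpos : 0 < growth r ε k := growth_pos fun i hi => (h1 i hi).1
    have h3 := h2 k
    simp only [G, hgrow] at h3
    rw [if_pos (by positivity)] at h3
    have h4 := Real.sqrt_le_sqrt h3
    rw [Real.sqrt_sq (by positivity)] at h4
    rwa [← le_div_iff₀ (by positivity), one_div]

/-! ### Existence of the combinatorial data -/

/-- The modulus to be used at step `k`: it is the one listed by the enumeration of all triples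
`(j, n, s)`, if that is not too large compared with the current value `R`. -/
def stepModulus (k R : ℕ) : ℕ :=
  if 1 ≤ k.unpair.1.unpair.2 ∧ k.unpair.1.unpair.2 ≤ R then k.unpair.1.unpair.2 else 1

/-- A sequence `r` with `4 r k < r (k + 1) < 6 r k` running through prescribed residue classes. -/
def residueSeq : ℕ → ℕ
  | 0 => 0
  | 1 => 4
  | k + 2 => 4 * residueSeq (k + 1) + 1 +
      (k.unpair.2.unpair.1 +
        (stepModulus k (residueSeq (k + 1)) - 1) * (4 * residueSeq (k + 1) + 1)) %
          stepModulus k (residueSeq (k + 1))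

/-- The values `j` of the enumeration of all triples `(j, n, s)`, cut down so as to be admissible.
The triple with index `k` governs both `residueSeq (k + 2)` and `linkSeq (k + 2)`. -/
def linkSeq (k : ℕ) : ℕ := min ((k - 2).unpair.1.unpair.1) (k - 1)

theorem one_le_stepModulus (k R : ℕ) : 1 ≤ stepModulus k R := by
  unfold stepModulus
  split_ifs with h1
  · exact h1.1
  · exact le_rfl

theorem stepModulus_le (k R : ℕ) (hR : 1 ≤ R) : stepModulus k R ≤ R := by
  unfold stepModulus
  split_ifs with h1
  · exact h1.2
  · exact hR

theorem residueSeq_bounds (k : ℕ) : 1 ≤ residueSeq (k + 1) ∧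
    4 * residueSeq (k + 1) < residueSeq (k + 2) ∧ residueSeq (k + 2) < 6 * residueSeq (k + 1) := by
  have hpos : 1 ≤ residueSeq (k + 1) := by
    rcases k with _ | k
    · simp [residueSeq]
    · rw [residueSeq]; omega
  refine ⟨hpos, ?_⟩
  rw [residueSeq]
  have h1 := one_le_stepModulus k (residueSeq (k + 1))
  have h2 := stepModulus_le k (residueSeq (k + 1)) hpos
  have h3 := Nat.mod_lt (k.unpair.2.unpair.1 +
    (stepModulus k (residueSeq (k + 1)) - 1) * (4 * residueSeq (k + 1) + 1)) h1
  constructor <;> omega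

theorem strictMono_residueSeq : StrictMono residueSeq := by
  refine strictMono_nat_of_lt_succ fun k => ?_
  rcases k with _ | k
  · simp [residueSeq]
  · have h1 := residueSeq_bounds k
    change residueSeq (k + 1) < residueSeq (k + 2)
    omega

theorem residueSeq_modEq (k : ℕ) : residueSeq (k + 2) ≡ k.unpair.2.unpair.1
    [MOD stepModulus k (residueSeq (k + 1))] := by
  rw [residueSeq]
  set n := stepModulus k (residueSeq (k + 1))
  set R := 4 * residueSeq (k + 1) + 1
  set s := k.unpair.2.unpair.1
  have h1 : 1 ≤ n := one_le_stepModulus _ _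
  calc R + (s + (n - 1) * R) % n ≡ R + (s + (n - 1) * R) [MOD n] :=
        (Nat.mod_modEq _ _).add_left _
    _ = s + n * R := by
        obtain ⟨q, hq⟩ : ∃ q, n = q + 1 := ⟨n - 1, by omega⟩
        rw [hq, Nat.add_sub_cancel]
        ring
    _ ≡ s [MOD n] := by simp [Nat.ModEq]

theorem isAmbroziePair_residueSeq : IsAmbroziePair residueSeq linkSeq where
  strictMono := strictMono_residueSeq
  r_zero := rfl
  r_one := rfl
  four_mul_lt k hk := by
    obtain ⟨k, rfl⟩ := Nat.exists_eq_add_of_le' hk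
    exact (residueSeq_bounds k).2.1
  lt_six_mul k hk := by
    obtain ⟨k, rfl⟩ := Nat.exists_eq_add_of_le' hk
    exact (residueSeq_bounds k).2.2
  h_le k _ := min_le_right _ _
  infinite j n s hj hn hs := by
    refine Set.infinite_of_forall_exists_gt fun w => ?_
    set k := Nat.pair (Nat.pair j n) (Nat.pair s w) with hk
    have hw : w ≤ k := (Nat.right_le_pair _ _).trans (Nat.right_le_pair _ _)
    have hjk : j ≤ k := (Nat.left_le_pair _ _).trans (Nat.left_le_pair _ _)
    have hnk : n ≤ k := (Nat.right_le_pair _ _).trans (Nat.left_le_pair _ _)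
    have hr : k + 1 ≤ residueSeq (k + 1) := strictMono_residueSeq.id_le (k + 1)
    have hmod := residueSeq_modEq k
    have hstep : stepModulus k (residueSeq (k + 1)) = n := by
      have h1 : k.unpair.1.unpair.2 = n := by simp [hk]
      unfold stepModulus
      rw [h1, if_pos ⟨hn, by omega⟩]
    have hs' : k.unpair.2.unpair.1 = s := by simp [hk]
    rw [hstep, hs'] at hmod
    refine ⟨k + 2, ⟨by omega, ?_, hmod⟩, by omega⟩
    have h1 : k.unpair.1.unpair.1 = j := by simp [hk]
    rw [linkSeq, Nat.add_sub_cancel, h1]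
    omega

/-! ### Properties of the extended operator -/

theorem exists_operator [CompleteSpace H] (e : HilbertBasis ℕ ℂ H) (hp : IsAmbroziePair r h)
    (hε : IsFast r ε) :
    ∃ T : H →L[ℂ] H, ExtendsOp e (op r h ε) T ∧ ‖T‖ ≤ 2 ∧ T ∈ nonScalar H ∧
      ¬ nonScalar H ⊆ commutant T ∧
      (∀ S ∈ nonScalar H, S ∈ commutant T → commutant S = commutant T) ∧
      (∀ K ∈ commutant T, IsCompactOperator K → K = 0) := by
  obtain ⟨T, hT, hnorm⟩ := exists_extension e hp hε
  have hT1 : T (e 1) = e 0 := by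
    rw [← embed_single, hT, op_single hp 0 1 (by rw [hp.r_zero]; omega)
      (by rw [zero_add, hp.r_one]; omega), ← embed_single]
  refine ⟨T, hT, hnorm, fun c hc => ?_, fun hsub => ?_,
    fun S hns hS => commutant_eq hp hε hT hS hns, fun K hK hcomp => ?_⟩
  · have h1 := congrArg (coord e 0) hT1
    rw [hc] at h1
    simp [coord_basis] at h1
  -- The orthogonal projection onto `e 0` is not scalar and does not commute with `T`.
  · have hP : ∀ j, (coord e 0).smulRight (e 0) (e j) = if 0 = j then e 0 else 0 := fun j => by
      rw [ContinuousLinearMap.smulRight_apply, coord_basis]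
      split_ifs <;> simp
    have hmem : (coord e 0).smulRight (e 0) ∈ nonScalar H := fun c hc => by
      have h0 := congrArg (coord e 0) (hP 0)
      have h1 := congrArg (coord e 1) (hP 1)
      rw [hc] at h0 h1
      simp [coord_basis] at h0 h1
      simp [h1] at h0
    have h1 := DFunLike.congr_fun (show T ∘L _ = _ ∘L T from hsub hmem) (e 1)
    rw [ContinuousLinearMap.comp_apply, ContinuousLinearMap.comp_apply, hT1, hP, hP] at h1
    have h2 := congrArg (coord e 0) h1
    simp [coord_basis] at h2
  · obtain ⟨a, ha⟩ := exists_isSeries_of_mem_commutant hp hε hT hK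
    exact ha.eq_zero_of_isCompactOperator hp hε hcomp

end

end Ambrozie

theorem theorem5p4 {H : Type*} [NormedAddCommGroup H] [InnerProductSpace ℂ H] [CompleteSpace H]
    (e : HilbertBasis ℕ ℂ H) :
    (∃ r h : ℕ → ℕ, IsAmbroziePair r h) ∧
    ∀ r h : ℕ → ℕ, IsAmbroziePair r h →
      HoldsForFastDecreasing fun ε =>
        ∃ T : H →L[ℂ] H,
          ExtendsOp e (Ambrozie.op r h ε) T ∧
          ‖T‖ ≤ 2 ∧
          T ∈ nonScalar H ∧
          ¬ nonScalar H ⊆ commutant T ∧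
          (∀ S ∈ nonScalar H, S ∈ commutant T → commutant S = commutant T) ∧
          (∀ K ∈ commutant T, IsCompactOperator K → K = 0) := by
  exact ⟨⟨_, _, Ambrozie.isAmbroziePair_residueSeq⟩, fun r _ hp =>
    Ambrozie.holdsForFastDecreasing_of_isFast r fun _ hε => Ambrozie.exists_operator e hp hε⟩
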